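/- Let $\mathbb{O}$ be the octonion algebra over $\mathbb{C}$ (the complexification of the classical real octonions, with $\mathbb{C}$-linear conjugation $x\mapsto\bar x$ and complex-valued real part $\mathrm{Re}$), let $\mathrm{Herm}(3,\mathbb{O})=\{A\in M(3,\mathbb{O}) : \bar A^T=A\}$ with the Jordan product $A\circ B=\tfrac12(AB+BA)$, and let $\mathrm{Herm}_0(3,\mathbb{O})$ be its subspace of trace-free matrices. Let $f:\mathrm{Herm}_0(3,\mathbb{O})\to \mathrm{Herm}(3,\mathbb{O})$, $f(A)=A^2$, and let $$\mathcal{A}=f^{-1}(0)\setminus\{0\}=\{A\in\mathrm{Herm}(3,\mathbb{O}) : A^2=0,\ \mathrm{tr}\,A=0,\ A\neq 0\}.$$ **Proposition.** The cone $\mathcal{A}$, with the subspace topology, is a smooth manifold of real dimension $32$, smoothly embedded in the real vector space underlying $\mathrm{Herm}_0(3,\mathbb{O})$; in fact it is an embedded complex submanifold of $\mathrm{Herm}_0(3,\mathbb{O})$ of complex dimension $16$. Moreover: 1. $f$ is holomorphic, its differential at $A$ is $B\mapsto 2A\circ B$, and this differential has constant complex rank, equal to $10$, on $\mathcal{A}$.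 2. At the canonical point $$A_0=\begin{pmatrix} i&1&0\\ 1&-i&0\\ 0&0&0\end{pmatrix}\in\mathcal{A}$$ the kernel of the differential of $f$ is $$\left\{\begin{pmatrix} i\,\mathrm{Re}(x_1)&x_1&x_2\\ \bar x_1&-i\,\mathrm{Re}(x_1)&-i x_2\\ \bar x_2&-i\bar x_2&0\end{pmatrix} : x_1,x_2\in\mathbb{O}\right\},$$ and this subspace is the tangent space of $\mathcal{A}$ at $A_0$ (the image of the differential of the inclusion $\mathcal{A}\hookrightarrow\mathrm{Herm}_0(3,\mathbb{O})$), for both the real and the complex manifold structure. -/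

import Mathlib

open scoped Quaternion ContDiff Manifold Matrix

/-- The algebra `𝕆` of octonions over `ℂ` (the complexification of the classical real octonions),
with its underlying space identified with `ℂ⁸`. The product is the Cayley–Dickson product built on
two copies of the quaternion algebra over `ℂ`. -/
def Octonion : Type := Fin 8 → ℂ

namespace Octonion

noncomputable instance : NormedAddCommGroup Octonion := inferInstanceAs (NormedAddCommGroup (Fin 8 → ℂ))

noncomputable instance : NormedSpace ℂ Octonion := inferInstanceAs (NormedSpace ℂ (Fin 8 → ℂ))

/-- The first quaternion component of an octonion. -/
def fst (x : Octonion) : ℍ[ℂ] := ⟨x 0, x 1, x 2, x 3⟩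

/-- The second quaternion component of an octonion. -/
def snd (x : Octonion) : ℍ[ℂ] := ⟨x 4, x 5, x 6, x 7⟩

/-- The octonion `(p, q)` with quaternion components `p` and `q`. -/
def mk (p q : ℍ[ℂ]) : Octonion :=
  ![p.re, p.imI, p.imJ, p.imK, q.re, q.imI, q.imJ, q.imK]

/-- `(a, b) (c, d) = (a c - d̄ b, d a + b c̄)`. The quaternion conjugation `star` on `ℍ[ℂ]` is
`ℂ`-linear: it negates the three imaginary components and does not conjugate coefficients. -/
noncomputable instance : Mul Octonion where
  mul x y := mk (x.fst * y.fst - star y.snd * x.snd) (y.snd * x.fst + x.snd * star y.fst)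

/-- The unit octonion. -/
noncomputable instance : One Octonion where
  one := mk 1 0

/-- The (`ℂ`-linear) octonionic conjugation `(a, b) ↦ (ā, -b)`. -/
noncomputable instance : Star Octonion where
  star x := mk (star x.fst) (-x.snd)

/-- The real part of an octonion, a complex number: `Re (o ⊗ z) = (Re o) z`. -/
def re (x : Octonion) : ℂ := x 0

theorem mul_def (x y : Octonion) :
    x * y = mk (x.fst * y.fst - star y.snd * x.snd) (y.snd * x.fst + x.snd * star y.fst) := rfl

theorem one_def : (1 : Octonion) = mk 1 0 := rfl

theorem star_def (x : Octonion) : star x = mk (star x.fst) (-x.snd) := rfl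

@[ext] theorem ext {x y : Octonion} (h : ∀ i : Fin 8, x i = y i) : x = y := funext h

@[simp] theorem add_apply (x y : Octonion) (i : Fin 8) : (x + y) i = x i + y i := rfl

@[simp] theorem neg_apply (x : Octonion) (i : Fin 8) : (-x) i = -x i := rfl

@[simp] theorem zero_apply (i : Fin 8) : (0 : Octonion) i = 0 := rfl

@[simp] theorem smul_apply (c : ℂ) (x : Octonion) (i : Fin 8) : (c • x) i = c * x i := rfl

@[simp] theorem mk_apply_zero (p q : ℍ[ℂ]) : mk p q 0 = p.re := rfl

@[simp] theorem mk_apply_one (p q : ℍ[ℂ]) : mk p q 1 = p.imI := rfl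

@[simp] theorem mk_apply_two (p q : ℍ[ℂ]) : mk p q 2 = p.imJ := rfl

@[simp] theorem mk_apply_three (p q : ℍ[ℂ]) : mk p q 3 = p.imK := rfl

@[simp] theorem mk_apply_four (p q : ℍ[ℂ]) : mk p q 4 = q.re := rfl

@[simp] theorem mk_apply_five (p q : ℍ[ℂ]) : mk p q 5 = q.imI := rfl

@[simp] theorem mk_apply_six (p q : ℍ[ℂ]) : mk p q 6 = q.imJ := rfl

@[simp] theorem mk_apply_seven (p q : ℍ[ℂ]) : mk p q 7 = q.imK := rfl

@[simp] theorem fst_re (x : Octonion) : x.fst.re = x 0 := rfl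

@[simp] theorem fst_imI (x : Octonion) : x.fst.imI = x 1 := rfl

@[simp] theorem fst_imJ (x : Octonion) : x.fst.imJ = x 2 := rfl

@[simp] theorem fst_imK (x : Octonion) : x.fst.imK = x 3 := rfl

@[simp] theorem snd_re (x : Octonion) : x.snd.re = x 4 := rfl

@[simp] theorem snd_imI (x : Octonion) : x.snd.imI = x 5 := rfl

@[simp] theorem snd_imJ (x : Octonion) : x.snd.imJ = x 6 := rfl

@[simp] theorem snd_imK (x : Octonion) : x.snd.imK = x 7 := rfl

theorem star_add' (x y : Octonion) : star (x + y) = star x + star y := by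
  ext i; fin_cases i <;> simp [star_def, add_comm]

theorem star_zero' : star (0 : Octonion) = 0 := by
  ext i; fin_cases i <;> simp [star_def]

theorem star_smul' (c : ℂ) (x : Octonion) : star (c • x) = c • star x := by
  ext i; fin_cases i <;> simp [star_def]

theorem star_one' : star (1 : Octonion) = 1 := by
  ext i; fin_cases i <;> simp [star_def, one_def]

theorem star_star' (x : Octonion) : star (star x) = x := by
  ext i; fin_cases i <;> simp [star_def]

theorem star_mul' (x y : Octonion) : star (x * y) = star y * star x := by
  ext i; fin_cases i <;> simp [star_def, mul_def] <;> ring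

theorem smul_one_mul (c : ℂ) (x : Octonion) : (c • (1 : Octonion)) * x = c • x := by
  ext i; fin_cases i <;> simp [one_def, mul_def] <;> ring

theorem mul_zero' (x : Octonion) : x * 0 = 0 := by
  ext i; fin_cases i <;> simp [mul_def]

theorem zero_mul' (x : Octonion) : 0 * x = 0 := by
  ext i; fin_cases i <;> simp [mul_def]

theorem one_mul' (x : Octonion) : 1 * x = x := by
  ext i; fin_cases i <;> simp [one_def, mul_def]

end Octonion

theorem conjTranspose_mul_octonion (A B : Matrix (Fin 3) (Fin 3) Octonion) :
    (A * B)ᴴ = Bᴴ * Aᴴ := by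
  ext1 i j
  simp [Matrix.conjTranspose_apply, Matrix.mul_apply, Fin.sum_univ_three, Octonion.star_add',
    Octonion.star_mul']

theorem conjTranspose_add_octonion (A B : Matrix (Fin 3) (Fin 3) Octonion) :
    (A + B)ᴴ = Aᴴ + Bᴴ := by
  ext1 i j
  simp [Matrix.conjTranspose_apply, Octonion.star_add']

theorem conjTranspose_smul_octonion (c : ℂ) (A : Matrix (Fin 3) (Fin 3) Octonion) :
    (c • A)ᴴ = c • Aᴴ := by
  ext1 i j
  simp [Matrix.conjTranspose_apply, Octonion.star_smul']

/-- The Hermitian octonionic `3 × 3` matrices as a `ℂ`-linear subspace of all `3 × 3` matrices. -/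
noncomputable def hermSubmodule : Submodule ℂ (Matrix (Fin 3) (Fin 3) Octonion) where
  carrier := {A | Aᴴ = A}
  add_mem' {A B} hA hB := by
    simp only [Set.mem_ofPred_eq] at *
    rw [conjTranspose_add_octonion, hA, hB]
  zero_mem' := by
    ext1 i j
    simp [Matrix.conjTranspose_apply, Octonion.star_zero']
  smul_mem' c A hA := by
    simp only [Set.mem_ofPred_eq] at *
    rw [conjTranspose_smul_octonion, hA]

/-- The trace-free Hermitian octonionic `3 × 3` matrices as a `ℂ`-linear subspace. -/
noncomputable def herm0Submodule : Submodule ℂ (Matrix (Fin 3) (Fin 3) Octonion) where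
  carrier := {A | Aᴴ = A ∧ A.trace = 0}
  add_mem' {A B} hA hB :=
    ⟨hermSubmodule.add_mem hA.1 hB.1, by rw [Matrix.trace_add, hA.2, hB.2, add_zero]⟩
  zero_mem' := ⟨hermSubmodule.zero_mem, Matrix.trace_zero _ _⟩
  smul_mem' c A hA :=
    ⟨hermSubmodule.smul_mem c hA.1, by rw [Matrix.trace_smul, hA.2, smul_zero]⟩

/-- The space `Herm(3, 𝕆)` of Hermitian octonionic `3 × 3` matrices, a finite-dimensional normed
space over `ℂ` (with the sup norm; any other norm gives the same smooth structure). -/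
def Herm : Type := hermSubmodule

/-- The space `Herm₀(3, 𝕆)` of trace-free Hermitian octonionic `3 × 3` matrices, a
finite-dimensional normed space over `ℂ`. -/
def Herm0 : Type := herm0Submodule

open scoped Matrix.Norms.Elementwise in
noncomputable instance : NormedAddCommGroup Herm :=
  inferInstanceAs (NormedAddCommGroup hermSubmodule)

open scoped Matrix.Norms.Elementwise in
noncomputable instance : NormedSpace ℂ Herm := inferInstanceAs (NormedSpace ℂ hermSubmodule)

open scoped Matrix.Norms.Elementwise in
noncomputable instance : NormedAddCommGroup Herm0 :=
  inferInstanceAs (NormedAddCommGroup herm0Submodule)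

open scoped Matrix.Norms.Elementwise in
noncomputable instance : NormedSpace ℂ Herm0 := inferInstanceAs (NormedSpace ℂ herm0Submodule)

/-- The underlying matrix of an element of `Herm(3, 𝕆)`. -/
def Herm.toMatrix (A : Herm) : Matrix (Fin 3) (Fin 3) Octonion := Subtype.val A

/-- The underlying matrix of an element of `Herm₀(3, 𝕆)`. -/
def Herm0.toMatrix (A : Herm0) : Matrix (Fin 3) (Fin 3) Octonion := Subtype.val A

theorem Herm.isHermitian (A : Herm) : A.toMatrixᴴ = A.toMatrix := Subtype.property A

theorem Herm0.isHermitian (A : Herm0) : A.toMatrixᴴ = A.toMatrix := (Subtype.property A).1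

theorem Herm0.trace_eq_zero (A : Herm0) : A.toMatrix.trace = 0 := (Subtype.property A).2

/-- A Hermitian matrix as an element of `Herm(3, 𝕆)`. -/
def Herm.of (A : Matrix (Fin 3) (Fin 3) Octonion) (hA : Aᴴ = A) : Herm :=
  (⟨A, hA⟩ : hermSubmodule)

/-- A trace-free Hermitian matrix as an element of `Herm₀(3, 𝕆)`. -/
def Herm0.of (A : Matrix (Fin 3) (Fin 3) Octonion) (hA : Aᴴ = A) (htr : A.trace = 0) : Herm0 :=
  (⟨A, hA, htr⟩ : herm0Submodule)

/-- The inclusion `Herm₀(3, 𝕆) ⊆ Herm(3, 𝕆)`. -/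
def Herm0.toHerm (A : Herm0) : Herm := Herm.of A.toMatrix A.isHermitian

/-- The Jordan product `A ∘ B = (AB + BA) / 2` on `Herm(3, 𝕆)`. -/
noncomputable def jordanMul (A B : Herm) : Herm :=
  Herm.of ((1 / 2 : ℂ) • (A.toMatrix * B.toMatrix + B.toMatrix * A.toMatrix)) (by
    rw [conjTranspose_smul_octonion, conjTranspose_add_octonion, conjTranspose_mul_octonion,
      conjTranspose_mul_octonion, A.isHermitian, B.isHermitian, add_comm])

/-- The map `f : Herm₀(3, 𝕆) → Herm(3, 𝕆)`, `f(A) = A²`. -/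
noncomputable def sqMap (A : Herm0) : Herm :=
  Herm.of (A.toMatrix * A.toMatrix) (by rw [conjTranspose_mul_octonion, A.isHermitian])

/-- The cone `𝒜 = f⁻¹(0) ∖ {0}`. -/
def cone : Set Herm0 := sqMap ⁻¹' {0} \ {0}

/-- As a set of matrices, the cone is `{A | A Hermitian, A² = 0, tr A = 0, A ≠ 0}`. -/
theorem toMatrix_image_cone :
    Herm0.toMatrix '' cone = {M | Mᴴ = M ∧ M * M = 0 ∧ M.trace = 0 ∧ M ≠ 0} := by
  ext M
  constructor
  · rintro ⟨A, ⟨h1, h2⟩, rfl⟩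
    exact ⟨A.isHermitian, congrArg Herm.toMatrix h1, A.trace_eq_zero, fun h => h2 (Subtype.ext h)⟩
  · rintro ⟨h1, h2, h3, h4⟩
    exact ⟨Herm0.of M h1 h3, ⟨Subtype.ext h2, fun h => h4 (congrArg Herm0.toMatrix h)⟩, rfl⟩

/-- The matrix with rows `(i, 1, 0)`, `(1, -i, 0)`, `(0, 0, 0)`. -/
noncomputable def canonicalMatrix : Matrix (Fin 3) (Fin 3) Octonion :=
  !![Complex.I • (1 : Octonion), 1, 0;
     1, -(Complex.I • (1 : Octonion)), 0;
     0, 0, 0]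

theorem canonicalMatrix_isHermitian : canonicalMatrixᴴ = canonicalMatrix := by
  have hneg (x : Octonion) : star (-x) = -star x := by
    rw [← neg_one_smul ℂ x, Octonion.star_smul', neg_one_smul]
  ext1 i j
  fin_cases i <;> fin_cases j <;>
    simp [canonicalMatrix, Matrix.conjTranspose_apply, Octonion.star_zero', Octonion.star_one',
      Octonion.star_smul', hneg]

theorem canonicalMatrix_trace : canonicalMatrix.trace = 0 := by
  simp [canonicalMatrix, Matrix.trace, Fin.sum_univ_three]

theorem canonicalMatrix_mul_self : canonicalMatrix * canonicalMatrix = 0 := by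
  ext i j k
  fin_cases i <;> fin_cases j <;>
    simp [canonicalMatrix, Matrix.mul_apply, Fin.sum_univ_three, Octonion.mul_zero',
      Octonion.zero_mul'] <;> fin_cases k <;>
    simp [Octonion.mul_def, Octonion.one_def]

/-- The canonical point of the cone. -/
noncomputable def canonicalPoint : Herm0 :=
  Herm0.of canonicalMatrix canonicalMatrix_isHermitian canonicalMatrix_trace

theorem canonicalPoint_mem_cone : canonicalPoint ∈ cone := by
  refine ⟨Subtype.ext canonicalMatrix_mul_self, fun h => ?_⟩
  have h1 : canonicalMatrix 0 1 = 0 :=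
    congrFun (congrFun (congrArg Herm0.toMatrix h) 0) 1
  have h2 := congrFun h1 0
  simp [canonicalMatrix, Octonion.one_def] at h2

/-- The matrix with rows `(i Re x₁, x₁, x₂)`, `(x̄₁, -i Re x₁, -i x₂)`, `(x̄₂, -i x̄₂, 0)`. -/
noncomputable def tangentMatrix (x₁ x₂ : Octonion) : Matrix (Fin 3) (Fin 3) Octonion :=
  !![(Complex.I * x₁.re) • (1 : Octonion), x₁, x₂;
     star x₁, -((Complex.I * x₁.re) • (1 : Octonion)), -(Complex.I • x₂);
     star x₂, -(Complex.I • star x₂), 0]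

/-- The set of elements of `Herm₀(3, 𝕆)` of the form `tangentMatrix x₁ x₂`. -/
def canonicalTangent : Set Herm0 := {B | ∃ x₁ x₂ : Octonion, B.toMatrix = tangentMatrix x₁ x₂}

/-! Write a Hermitian matrix as three scalars `a, b, c` and three octonions `x, y, z`. If the trace
and the square vanish, then `a² = -(N(y) + N(z))`, `a b = N(z)` and `a x` is the conjugate of `y z`.
When `a ≠ 0`, these relations conversely imply that the square vanishes, by alternativity and
multiplicativity of the norm form `N`. So near a point with `a ≠ 0` the cone is the graph of a
holomorphic function of `(y, z) ∈ ℂ¹⁶`, once a branch of the square root giving `a` is fixed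
(`coneLocalGraph`).

The other points are reached by linear symmetries preserving squares and traces: cyclic permutation,
triality maps and one orthogonal reflection. Every nonzero element can be moved to one with `a ≠ 0`
(`exists_isSymmetry`), so the cone is a graph near each of its points.

The tangent space lies in the kernel of the differential of `f`, because `f` is constant on the
cone. That kernel contains no nonzero vertical vector of the graph (`eq_zero_of_sq_add`), so the two
spaces coincide (`range_fderiv_param`). The kernel thus has dimension 16, and the rank is `26 - 16 =
10`. The real structure comes from the same graphs by restriction of scalars. -/

section LocalGraph

/-! ### Submanifolds given locally as graphs. -/

variable {𝕜 : Type*} [NontriviallyNormedField 𝕜]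
  {E H H' K K' : Type*} [NormedAddCommGroup E] [NormedSpace 𝕜 E]
  [NormedAddCommGroup H] [NormedSpace 𝕜 H] [NormedAddCommGroup H'] [NormedSpace 𝕜 H']
  [NormedAddCommGroup K] [NormedSpace 𝕜 K] [NormedAddCommGroup K'] [NormedSpace 𝕜 K']
  {n : ℕ∞ω} {S : Set E} {p : E}

/-- A presentation of the set `S` near the point `p` as the graph of a `C^n` function `ψ : H → K`,
with respect to the splitting `e` of the ambient space. -/
structure LocalGraph (n : ℕ∞ω) (S : Set E) (p : E) (e : (H × K) ≃L[𝕜] E) where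
  /-- The neighbourhood of `p` on which `S` is a graph. -/
  U : Set E
  /-- The domain of the function. -/
  V : Set H
  /-- The function. -/
  ψ : H → K
  isOpen_U : IsOpen U
  isOpen_V : IsOpen V
  mem : p ∈ S ∩ U
  contDiffOn : ContDiffOn 𝕜 n ψ V
  apply_mem : ∀ v ∈ V, e (v, ψ v) ∈ S ∩ U
  fst_mem : ∀ A ∈ S ∩ U, (e.symm A).1 ∈ V
  snd_eq : ∀ A ∈ S ∩ U, (e.symm A).2 = ψ (e.symm A).1

namespace LocalGraph

variable {e : (H × K) ≃L[𝕜] E} (G : LocalGraph n S p e)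

/-- The parametrization of `S` by the graph. -/
def param (v : H) : E := e (v, G.ψ v)

include G in
theorem contDiffOn_param : ContDiffOn 𝕜 n G.param G.V :=
  e.contDiff.comp_contDiffOn (contDiffOn_id.prodMk G.contDiffOn)

theorem param_fst {A : E} (hA : A ∈ S ∩ G.U) : G.param (e.symm A).1 = A := by
  rw [param, ← G.snd_eq A hA, Prod.mk.eta, e.apply_symm_apply]

theorem symm_param (v : H) : e.symm (G.param v) = (v, G.ψ v) := e.symm_apply_apply _

open scoped Classical in
/-- The chart on `S` which projects the graph to its domain. -/
noncomputable def chart : OpenPartialHomeomorph S H where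
  toFun A := (e.symm A).1
  -- Outside `V` the value `p` is only a filler that makes the inverse total.
  invFun v := if h : v ∈ G.V then ⟨G.param v, (G.apply_mem v h).1⟩ else ⟨p, G.mem.1⟩
  source := Subtype.val ⁻¹' G.U
  target := G.V
  map_source' A hA := G.fst_mem A ⟨A.2, hA⟩
  map_target' v hv := by simpa [hv, param] using (G.apply_mem v hv).2
  left_inv' A hA := by
    have h := G.fst_mem A ⟨A.2, hA⟩
    simp only [h, dif_pos]
    exact Subtype.ext (G.param_fst ⟨A.2, hA⟩)
  right_inv' v hv := by simp [hv, symm_param]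
  open_source := G.isOpen_U.preimage continuous_subtype_val
  open_target := G.isOpen_V
  continuousOn_toFun := by fun_prop
  continuousOn_invFun := by
    rw [Topology.IsInducing.subtypeVal.continuousOn_iff]
    exact G.contDiffOn_param.continuousOn.congr fun v hv => by simp [hv]

@[simp] theorem chart_apply (A : S) : G.chart A = (e.symm A).1 := rfl

open scoped Classical in
theorem coe_chart_symm {v : H} (hv : v ∈ G.V) : (G.chart.symm v : E) = G.param v := by
  change ((if h : v ∈ G.V then (⟨G.param v, (G.apply_mem v h).1⟩ : S) else ⟨p, G.mem.1⟩ : S) : E) = _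
  rw [dif_pos hv]

theorem mem_chart_source : (⟨p, G.mem.1⟩ : S) ∈ G.chart.source := G.mem.2

/-- The chart of the ambient space which flattens the graph. -/
def flatten : OpenPartialHomeomorph E E where
  toFun A := A - e (0, G.ψ (e.symm A).1)
  invFun A := A + e (0, G.ψ (e.symm A).1)
  source := {A | (e.symm A).1 ∈ G.V}
  target := {A | (e.symm A).1 ∈ G.V}
  map_source' A hA := by simpa using hA
  map_target' A hA := by simpa using hA
  left_inv' A _ := by simp
  right_inv' A _ := by simp
  open_source := G.isOpen_V.preimage (by fun_prop)
  open_target := G.isOpen_V.preimage (by fun_prop)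
  continuousOn_toFun := by
    refine continuousOn_id.sub (e.continuous.comp_continuousOn (continuousOn_const.prodMk
      (G.contDiffOn.continuousOn.comp (by fun_prop) fun _ hA => hA)))
  continuousOn_invFun := by
    refine continuousOn_id.add (e.continuous.comp_continuousOn (continuousOn_const.prodMk
      (G.contDiffOn.continuousOn.comp (by fun_prop) fun _ hA => hA)))

theorem contDiffOn_shift :
    ContDiffOn 𝕜 n (fun A => e (0, G.ψ (e.symm A).1)) {A | (e.symm A).1 ∈ G.V} :=
  e.contDiff.comp_contDiffOn (contDiffOn_const.prodMk
    (G.contDiffOn.comp (contDiff_fst.comp e.symm.contDiff).contDiffOn fun _ hA => hA))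

/-- The flattening is a shear along `K`; its inverse is the shear with the opposite sign, so both
are `C^n` because `ψ` is. -/
theorem flatten_mem_maximalAtlas : G.flatten ∈ IsManifold.maximalAtlas 𝓘(𝕜, E) n E := by
  rw [IsManifold.mem_maximalAtlas_iff_contMDiffOn]
  exact ⟨contMDiffOn_iff_contDiffOn.2 (contDiffOn_id.sub G.contDiffOn_shift),
    contMDiffOn_iff_contDiffOn.2 (contDiffOn_id.add G.contDiffOn_shift)⟩

theorem flatten_param (v : H) : G.flatten (G.param v) = e (v, 0) := by
  change G.param v - e (0, G.ψ (e.symm (G.param v)).1) = _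
  rw [symm_param, param, ← map_sub]
  simp

/-- The restriction of scalars of a continuous linear equivalence. -/
def _root_.ContinuousLinearEquiv.restrictScalarsEquiv {𝕜 : Type*} (𝕜' : Type*) {M N : Type*}
    [Semiring 𝕜] [Semiring 𝕜'] [AddCommMonoid M] [AddCommMonoid N] [TopologicalSpace M]
    [TopologicalSpace N] [Module 𝕜 M] [Module 𝕜 N] [Module 𝕜' M] [Module 𝕜' N]
    [LinearMap.CompatibleSMul M N 𝕜' 𝕜] (e : M ≃L[𝕜] N) : M ≃L[𝕜'] N where
  toLinearEquiv := e.toLinearEquiv.restrictScalars 𝕜'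
  continuous_toFun := e.continuous
  continuous_invFun := e.symm.continuous

@[simp] theorem _root_.ContinuousLinearEquiv.restrictScalarsEquiv_symm_apply {𝕜 : Type*}
    (𝕜' : Type*) {M N : Type*}
    [Semiring 𝕜] [Semiring 𝕜'] [AddCommMonoid M] [AddCommMonoid N] [TopologicalSpace M]
    [TopologicalSpace N] [Module 𝕜 M] [Module 𝕜 N] [Module 𝕜' M] [Module 𝕜' N]
    [LinearMap.CompatibleSMul M N 𝕜' 𝕜] (e : M ≃L[𝕜] N) (x : N) :
    (e.restrictScalarsEquiv 𝕜').symm x = e.symm x := rfl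

/-- The restriction of scalars of a local graph, with the domain of the function replaced by an
isomorphic space. -/
noncomputable def restrictScalars {𝕜' : Type*} [NontriviallyNormedField 𝕜'] [NormedAlgebra 𝕜' 𝕜]
    [NormedSpace 𝕜' E] [NormedSpace 𝕜' H] [NormedSpace 𝕜' H'] [NormedSpace 𝕜' K]
    [IsScalarTower 𝕜' 𝕜 E] [IsScalarTower 𝕜' 𝕜 H] [IsScalarTower 𝕜' 𝕜 K]
    {m : ℕ∞ω} (hm : m ≤ n) (f : H' ≃L[𝕜'] H) :
    LocalGraph m S p ((f.prodCongr (.refl 𝕜' K)).trans (e.restrictScalarsEquiv 𝕜')) where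
  U := G.U
  V := f ⁻¹' G.V
  ψ := G.ψ ∘ f
  isOpen_U := G.isOpen_U
  isOpen_V := G.isOpen_V.preimage f.continuous
  mem := G.mem
  contDiffOn := ((G.contDiffOn.of_le hm).restrict_scalars 𝕜').comp f.contDiff.contDiffOn
    fun _ h => h
  apply_mem v hv := G.apply_mem (f v) hv
  fst_mem A hA := by simpa using G.fst_mem A hA
  snd_eq A hA := by simpa using G.snd_eq A hA

/-- The image of a local graph under a linear symmetry of `S`. -/
def symmetry {p : E} (g : E ≃L[𝕜] E) (hg : ∀ A, g A ∈ S ↔ A ∈ S) (G : LocalGraph n S (g p) e) :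
    LocalGraph n S p (e.trans g.symm) where
  U := g ⁻¹' G.U
  V := G.V
  ψ := G.ψ
  isOpen_U := G.isOpen_U.preimage g.continuous
  isOpen_V := G.isOpen_V
  mem := ⟨(hg p).1 G.mem.1, G.mem.2⟩
  contDiffOn := G.contDiffOn
  apply_mem v hv := by
    have := G.apply_mem v hv
    exact ⟨(hg _).1 (by simpa using this.1), by simpa using this.2⟩
  fst_mem A hA := G.fst_mem (g A) ⟨(hg A).2 hA.1, hA.2⟩
  snd_eq A hA := G.snd_eq (g A) ⟨(hg A).2 hA.1, hA.2⟩

end LocalGraph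

/-- The charts of a covering of `S` by local graphs. -/
@[reducible] noncomputable def chartedSpaceOfLocalGraph {e : S → (H × K) ≃L[𝕜] E}
    (G : ∀ q : S, LocalGraph n S q.1 (e q)) : ChartedSpace H S where
  atlas := Set.range fun q => (G q).chart
  chartAt q := (G q).chart
  mem_chart_source q := (G q).mem_chart_source
  chart_mem_atlas q := ⟨q, rfl⟩

section

variable {e : S → (H × K) ≃L[𝕜] E} (G : ∀ q : S, LocalGraph n S q.1 (e q))

/-- A transition map is a parametrization followed by a linear projection, hence `C^n` without any
appeal to the inverse function theorem. -/
theorem isManifold_of_localGraph :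
    letI := chartedSpaceOfLocalGraph G
    IsManifold 𝓘(𝕜, H) n S := by
  let := chartedSpaceOfLocalGraph G
  refine isManifold_of_contDiffOn _ _ _ ?_
  rintro _ _ ⟨q, rfl⟩ ⟨r, rfl⟩
  have h : ContDiffOn 𝕜 n (fun v => ((e r).symm ((G q).param v)).1) (G q).V :=
    (contDiff_fst.comp (e r).symm.contDiff).comp_contDiffOn (G q).contDiffOn_param
  refine (h.mono fun v hv => ?_).congr fun v hv => ?_
  · exact hv.1.1
  · have hv' : v ∈ (G q).V := hv.1.1
    simp [(G q).coe_chart_symm hv']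

/-- Between the graph chart and the flattened ambient chart, the inclusion becomes `v ↦ e (v, 0)`,
the model immersion with complement `K`. -/
theorem isSmoothEmbedding_of_localGraph :
    letI := chartedSpaceOfLocalGraph G
    Manifold.IsSmoothEmbedding 𝓘(𝕜, H) 𝓘(𝕜, E) n (Subtype.val : S → E) := by
  let := chartedSpaceOfLocalGraph G
  have := isManifold_of_localGraph G
  refine ⟨Manifold.IsImmersionOfComplement.isImmersion (F := K) fun q => ?_, .subtypeVal⟩
  refine .mk_of_continuousAt continuous_subtype_val.continuousAt (e q) (G q).chart (G q).flatten
    (G q).mem_chart_source ((G q).fst_mem _ (G q).mem)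
    (IsManifold.subset_maximalAtlas ⟨q, rfl⟩) (G q).flatten_mem_maximalAtlas fun v hv => ?_
  have hv' : v ∈ (G q).V := hv.2
  simp [(G q).coe_chart_symm hv', (G q).flatten_param]

theorem mfderiv_val_of_localGraph (hn : n ≠ 0) (q : S) :
    letI := chartedSpaceOfLocalGraph G
    mfderiv 𝓘(𝕜, H) 𝓘(𝕜, E) (Subtype.val : S → E) q =
      fderiv 𝕜 (G q).param ((e q).symm q).1 := by
  let := chartedSpaceOfLocalGraph G
  have := isManifold_of_localGraph G
  have hd : MDifferentiableAt 𝓘(𝕜, H) 𝓘(𝕜, E) (Subtype.val : S → E) q :=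
    (isSmoothEmbedding_of_localGraph G).contMDiff.mdifferentiableAt hn
  refine hd.mfderiv.trans ?_
  rw [modelWithCornersSelf_coe, Set.range_id, fderivWithin_univ]
  refine Filter.EventuallyEq.fderiv_eq ?_
  filter_upwards [(G q).isOpen_V.mem_nhds ((G q).fst_mem _ (G q).mem)] with v hv
  exact (G q).coe_chart_symm hv

/-- The tangent space of a local graph is the kernel of any differential `L` of a function which
is constant on `S`, as soon as it meets the vertical space of the graph trivially. -/
theorem range_fderiv_param {W : Type*} [NormedAddCommGroup W] [NormedSpace 𝕜 W] {p : E}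
    {e : (H × K) ≃L[𝕜] E} (G : LocalGraph n S p e) (hn : n ≠ 0) {F : E → W} {c : W}
    {L : E →L[𝕜] W} (hF : HasFDerivAt F L p) (hS : ∀ A ∈ S, F A = c)
    (hL : ∀ B, L B = 0 → (e.symm B).1 = 0 → B = 0) :
    Set.range (fderiv 𝕜 G.param (e.symm p).1) = {B | L B = 0} ∧
      Function.Injective (fderiv 𝕜 G.param (e.symm p).1) := by
  have hV := G.isOpen_V.mem_nhds (G.fst_mem p G.mem)
  have hp : HasFDerivAt G.param (fderiv 𝕜 G.param (e.symm p).1) (e.symm p).1 :=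
    ((G.contDiffOn_param.contDiffAt hV).differentiableAt hn).hasFDerivAt
  set D := fderiv 𝕜 G.param (e.symm p).1
  -- `F ∘ param` is constant near the base point, so the chain rule gives `L ∘ D = 0`.
  have h1 : ∀ v, L (D v) = 0 := by
    have hF' : HasFDerivAt F L (G.param (e.symm p).1) := by rwa [G.param_fst G.mem]
    have h2 := hF'.comp _ hp
    have h3 : HasFDerivAt (F ∘ G.param) (0 : H →L[𝕜] W) (e.symm p).1 := by
      refine (hasFDerivAt_const c _).congr_of_eventuallyEq ?_
      filter_upwards [hV] with v hv
      exact hS _ (G.apply_mem v hv).1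
    exact fun v => congrArg (fun T : H →L[𝕜] W => T v) (h2.unique h3)
  -- The horizontal projection is a linear left inverse of `param`, hence also of its derivative.
  have h4 : ∀ v, (e.symm (D v)).1 = v := by
    have h5 := ((ContinuousLinearMap.fst 𝕜 H K).comp
      (e.symm : E →L[𝕜] H × K)).hasFDerivAt.comp _ hp
    have hid : (ContinuousLinearMap.fst 𝕜 H K).comp (e.symm : E →L[𝕜] H × K) ∘ G.param = id :=
      funext fun v => congrArg Prod.fst (G.symm_param v)
    rw [hid] at h5
    have h6 := h5.unique (hasFDerivAt_id (𝕜 := 𝕜) (e.symm p).1)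
    exact fun v => congrArg (fun T : H →L[𝕜] H => T v) h6
  refine ⟨Set.Subset.antisymm (by rintro _ ⟨v, rfl⟩; exact h1 v) fun B hB => ?_,
    Function.LeftInverse.injective (g := fun B => (e.symm B).1) h4⟩
  -- `D` applied to the horizontal part of `B` differs from `B` by a vertical vector killed by `L`,
  -- which is zero by `hL`.
  refine ⟨(e.symm B).1, sub_eq_zero.1 (hL _ ?_ ?_)⟩
  · rw [map_sub, h1, hB, sub_zero]
  · rw [map_sub, Prod.fst_sub, h4, sub_self]

end

end LocalGraph

/-! ### Algebraic identities of the octonions. -/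

namespace Octonion

instance : FiniteDimensional ℂ Octonion := inferInstanceAs (FiniteDimensional ℂ (Fin 8 → ℂ))

theorem finrank_eq : Module.finrank ℂ Octonion = 8 :=
  (Module.finrank_fin_fun ℂ : Module.finrank ℂ (Fin 8 → ℂ) = 8)

@[simp] theorem sub_apply (x y : Octonion) (i : Fin 8) : (x - y) i = x i - y i := rfl

/-- The norm form of the octonions. -/
def normSq (x : Octonion) : ℂ :=
  x 0 ^ 2 + x 1 ^ 2 + x 2 ^ 2 + x 3 ^ 2 + x 4 ^ 2 + x 5 ^ 2 + x 6 ^ 2 + x 7 ^ 2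

/-- With the product in coordinates, each octonion identity becomes a family of polynomial
identities that `ring` can decide. -/
theorem mul_coord (x y : Octonion) :
    (x * y) 0 =
      x 0 * y 0 - x 1 * y 1 - x 2 * y 2 - x 3 * y 3 - x 4 * y 4 - x 5 * y 5 - x 6 * y 6 - x 7 * y 7 ∧
    (x * y) 1 =
      x 0 * y 1 + x 1 * y 0 + x 2 * y 3 - x 3 * y 2 + x 4 * y 5 - x 5 * y 4 - x 6 * y 7 + x 7 * y 6 ∧
    (x * y) 2 =
      x 0 * y 2 - x 1 * y 3 + x 2 * y 0 + x 3 * y 1 + x 4 * y 6 + x 5 * y 7 - x 6 * y 4 - x 7 * y 5 ∧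
    (x * y) 3 =
      x 0 * y 3 + x 1 * y 2 - x 2 * y 1 + x 3 * y 0 + x 4 * y 7 - x 5 * y 6 + x 6 * y 5 - x 7 * y 4 ∧
    (x * y) 4 =
      x 0 * y 4 - x 1 * y 5 - x 2 * y 6 - x 3 * y 7 + x 4 * y 0 + x 5 * y 1 + x 6 * y 2 + x 7 * y 3 ∧
    (x * y) 5 =
      x 0 * y 5 + x 1 * y 4 - x 2 * y 7 + x 3 * y 6 - x 4 * y 1 + x 5 * y 0 - x 6 * y 3 + x 7 * y 2 ∧
    (x * y) 6 =
      x 0 * y 6 + x 1 * y 7 + x 2 * y 4 - x 3 * y 5 - x 4 * y 2 + x 5 * y 3 + x 6 * y 0 - x 7 * y 1 ∧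
    (x * y) 7 =
      x 0 * y 7 - x 1 * y 6 + x 2 * y 5 + x 3 * y 4 - x 4 * y 3 - x 5 * y 2 + x 6 * y 1 + x 7 * y 0 := by
  refine ⟨?_, ?_, ?_, ?_, ?_, ?_, ?_, ?_⟩ <;> simp [mul_def] <;> ring

theorem star_coord (x : Octonion) :
    star x 0 = x 0 ∧ star x 1 = -x 1 ∧ star x 2 = -x 2 ∧ star x 3 = -x 3 ∧
    star x 4 = -x 4 ∧ star x 5 = -x 5 ∧ star x 6 = -x 6 ∧ star x 7 = -x 7 := by
  simp [star_def]

theorem one_coord :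
    (1 : Octonion) 0 = 1 ∧ (1 : Octonion) 1 = 0 ∧ (1 : Octonion) 2 = 0 ∧ (1 : Octonion) 3 = 0 ∧
    (1 : Octonion) 4 = 0 ∧ (1 : Octonion) 5 = 0 ∧ (1 : Octonion) 6 = 0 ∧ (1 : Octonion) 7 = 0 := by
  simp [one_def]

theorem ext_coord {x y : Octonion} (h0 : x 0 = y 0) (h1 : x 1 = y 1) (h2 : x 2 = y 2)
    (h3 : x 3 = y 3) (h4 : x 4 = y 4) (h5 : x 5 = y 5) (h6 : x 6 = y 6) (h7 : x 7 = y 7) :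
    x = y := by
  ext i; fin_cases i <;> assumption

theorem add_mul' (x y z : Octonion) : (x + y) * z = x * z + y * z := by
  apply ext_coord <;> simp only [add_apply, mul_coord] <;> ring

theorem mul_add' (x y z : Octonion) : x * (y + z) = x * y + x * z := by
  apply ext_coord <;> simp only [add_apply, mul_coord] <;> ring

theorem smul_mul' (c : ℂ) (x y : Octonion) : (c • x) * y = c • (x * y) := by
  apply ext_coord <;> simp only [smul_apply, mul_coord] <;> ring

theorem mul_smul' (c : ℂ) (x y : Octonion) : x * (c • y) = c • (x * y) := by
  apply ext_coord <;> simp only [smul_apply, mul_coord] <;> ring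

theorem mul_one' (x : Octonion) : x * 1 = x := by
  apply ext_coord <;> simp [mul_coord, one_coord]

theorem mul_star_self (x : Octonion) : x * star x = x.normSq • (1 : Octonion) := by
  apply ext_coord <;> simp [smul_apply, mul_coord, star_coord, one_coord, normSq] <;> ring

theorem star_mul_self (x : Octonion) : star x * x = x.normSq • (1 : Octonion) := by
  apply ext_coord <;> simp [smul_apply, mul_coord, star_coord, one_coord, normSq] <;> ring

theorem normSq_star (x : Octonion) : (star x).normSq = x.normSq := by
  simp [star_coord, normSq]

theorem normSq_smul (c : ℂ) (x : Octonion) : (c • x).normSq = c ^ 2 * x.normSq := by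
  simp only [normSq, smul_apply]; ring

theorem normSq_mul (x y : Octonion) : (x * y).normSq = x.normSq * y.normSq := by
  simp only [normSq, mul_coord]; ring

/-- This and the next three identities are the cancellation laws of an alternative algebra; they
replace associativity below. -/
theorem mul_star_mul (x y : Octonion) : x * (star x * y) = x.normSq • y := by
  apply ext_coord <;> simp only [smul_apply, mul_coord, star_coord, normSq] <;> ring

theorem star_mul_mul (x y : Octonion) : star x * (x * y) = x.normSq • y := by
  apply ext_coord <;> simp only [smul_apply, mul_coord, star_coord, normSq] <;> ring

theorem mul_mul_star (x y : Octonion) : (x * y) * star y = y.normSq • x := by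
  apply ext_coord <;> simp only [smul_apply, mul_coord, star_coord, normSq] <;> ring

theorem mul_star_mul_self (x y : Octonion) : (x * star y) * y = y.normSq • x := by
  apply ext_coord <;> simp only [smul_apply, mul_coord, star_coord, normSq] <;> ring

theorem flexible (x y : Octonion) : (x * y) * x = x * (y * x) := by
  apply ext_coord <;> simp only [mul_coord] <;> ring

/-- The Moufang identities are what makes the triality maps compatible with products. -/
theorem middle_moufang (u x y : Octonion) : (u * x) * (y * u) = u * (x * y) * u := by
  apply ext_coord <;> simp only [mul_coord] <;> ring

theorem right_moufang (x u y : Octonion) : ((x * u) * y) * u = x * (u * y * u) := by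
  apply ext_coord <;> simp only [mul_coord] <;> ring

end Octonion

/-! ### Smoothness of the octonion operations. -/

namespace Octonion

/-- The octonion multiplication as a bilinear map. -/
noncomputable def mulBilin : Octonion →ₗ[ℂ] Octonion →ₗ[ℂ] Octonion :=
  LinearMap.mk₂ ℂ (· * ·) add_mul' smul_mul' mul_add' mul_smul'

/-- The octonionic conjugation as a linear map. -/
noncomputable def starLinear : Octonion →ₗ[ℂ] Octonion where
  toFun := star
  map_add' := star_add'
  map_smul' := star_smul'

/-- The coordinates of an octonion as linear maps. -/
def coordLinear (i : Fin 8) : Octonion →ₗ[ℂ] ℂ where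
  toFun x := x i
  map_add' _ _ := rfl
  map_smul' _ _ := rfl

theorem contDiff_mul {n : ℕ∞ω} : ContDiff ℂ n fun p : Octonion × Octonion => p.1 * p.2 :=
  mulBilin.toContinuousBilinearMap.isBoundedBilinearMap.contDiff

theorem contDiff_star {n : ℕ∞ω} : ContDiff ℂ n fun x : Octonion => star x :=
  starLinear.toContinuousLinearMap.contDiff

theorem contDiff_coord {n : ℕ∞ω} (i : Fin 8) : ContDiff ℂ n fun x : Octonion => x i :=
  (coordLinear i).toContinuousLinearMap.contDiff

theorem contDiff_normSq {n : ℕ∞ω} : ContDiff ℂ n normSq := by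
  have h i : ContDiff ℂ n fun x : Octonion => x i ^ 2 := (contDiff_coord i).pow 2
  exact ((((((((h 0).add (h 1)).add (h 2)).add (h 3)).add (h 4)).add (h 5)).add (h 6)).add (h 7))

/-- Conjugation negates the seven imaginary coordinates. This is why the diagonal entries of a
Hermitian matrix are scalars. -/
theorem eq_smul_one_of_star_eq {x : Octonion} (h : star x = x) : x = x 0 • (1 : Octonion) := by
  have h' i : star x i = x i := congrArg (fun y : Octonion => y i) h
  have h1 := h' 1
  have h2 := h' 2
  have h3 := h' 3
  have h4 := h' 4
  have h5 := h' 5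
  have h6 := h' 6
  have h7 := h' 7
  simp only [star_coord, neg_eq_self] at h1 h2 h3 h4 h5 h6 h7
  apply ext_coord <;> simp [one_coord, *]

end Octonion

/-! ### Coordinates on Hermitian matrices. -/

open Octonion

/-- The coordinates `((a, b, c), (x, y, z))` of the Hermitian matrix
`(a, z, ȳ), (z̄, b, x), (y, x̄, c)`. -/
abbrev HermCoord : Type := (ℂ × ℂ × ℂ) × (Octonion × Octonion × Octonion)

namespace HermCoord

/-- The Hermitian matrix with the given coordinates. -/
noncomputable def toMatrix (p : HermCoord) : Matrix (Fin 3) (Fin 3) Octonion :=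
  !![p.1.1 • (1 : Octonion), p.2.2.2, star p.2.2.1;
     star p.2.2.2, p.1.2.1 • (1 : Octonion), p.2.1;
     p.2.2.1, star p.2.1, p.1.2.2 • (1 : Octonion)]

theorem toMatrix_isHermitian (p : HermCoord) : p.toMatrixᴴ = p.toMatrix := by
  ext1 i j
  fin_cases i <;> fin_cases j <;>
    simp [toMatrix, Matrix.conjTranspose_apply, star_star', star_smul', star_one']

/-- The trace of the Hermitian matrix with the given coordinates. -/
def trace (p : HermCoord) : ℂ := p.1.1 + p.1.2.1 + p.1.2.2

theorem toMatrix_trace (p : HermCoord) : p.toMatrix.trace = p.trace • (1 : Octonion) := by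
  simp [toMatrix, Matrix.trace, Fin.sum_univ_three, trace, add_smul]

/-- The coordinates of the square of a Hermitian matrix. -/
noncomputable def sq (p : HermCoord) : HermCoord :=
  ((p.1.1 ^ 2 + normSq p.2.2.1 + normSq p.2.2.2, p.1.2.1 ^ 2 + normSq p.2.1 + normSq p.2.2.2,
    p.1.2.2 ^ 2 + normSq p.2.1 + normSq p.2.2.1),
   ((p.1.2.1 + p.1.2.2) • p.2.1 + star (p.2.2.1 * p.2.2.2),
    (p.1.2.2 + p.1.1) • p.2.2.1 + star (p.2.2.2 * p.2.1),
    (p.1.1 + p.1.2.1) • p.2.2.2 + star (p.2.1 * p.2.2.1)))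

/-- Each entry of the square is a sum of products of just two octonions, so no associativity is
needed. The equation `A² = 0` becomes three scalar and three octonionic equations. -/
theorem toMatrix_mul_self (p : HermCoord) : p.toMatrix * p.toMatrix = p.sq.toMatrix := by
  have h (a : ℂ) (x : Octonion) : x * (a • (1 : Octonion)) = a • x := by rw [mul_smul', mul_one']
  ext1 i j
  fin_cases i <;> fin_cases j <;>
    simp [toMatrix, sq, Matrix.mul_apply, Fin.sum_univ_three, smul_one_mul, h, star_star',
      star_add', star_smul', star_mul', mul_star_self, star_mul_self, smul_smul] <;>
    module

end HermCoord

theorem Herm.ext {A B : Herm} (h : A.toMatrix = B.toMatrix) : A = B := Subtype.ext h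

theorem Herm0.ext {A B : Herm0} (h : A.toMatrix = B.toMatrix) : A = B := Subtype.ext h

theorem Herm.apply_eq_star (A : Herm) (i j : Fin 3) : star (A.toMatrix j i) = A.toMatrix i j :=
  congrFun (congrFun A.isHermitian i) j

/-- The coordinates on `Herm(3, 𝕆)`. -/
noncomputable def Herm.coord : Herm ≃ₗ[ℂ] HermCoord where
  toFun A := ((A.toMatrix 0 0 0, A.toMatrix 1 1 0, A.toMatrix 2 2 0),
    (A.toMatrix 1 2, A.toMatrix 2 0, A.toMatrix 0 1))
  map_add' _ _ := rfl
  map_smul' _ _ := rfl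
  invFun p := Herm.of p.toMatrix p.toMatrix_isHermitian
  left_inv A := by
    refine Herm.ext ?_
    have h (i : Fin 3) := (eq_smul_one_of_star_eq (A.apply_eq_star i i)).symm
    ext1 i j
    change HermCoord.toMatrix _ i j = _
    fin_cases i <;> fin_cases j <;> simp [HermCoord.toMatrix, A.apply_eq_star, h]
  right_inv p := by
    have h (c : ℂ) : (c • (1 : Octonion)) 0 = c := by rw [smul_apply, one_coord.1, mul_one]
    change (((p.1.1 • (1 : Octonion)) 0, (p.1.2.1 • (1 : Octonion)) 0,
      (p.1.2.2 • (1 : Octonion)) 0), p.2) = p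
    rw [h, h, h]

theorem Herm.coord_symm_toMatrix (p : HermCoord) : (Herm.coord.symm p).toMatrix = p.toMatrix := rfl

theorem Herm.toMatrix_coord (A : Herm) : (Herm.coord A).toMatrix = A.toMatrix := by
  rw [← Herm.coord_symm_toMatrix, LinearEquiv.symm_apply_apply]

theorem Herm.coord_eq_of_toMatrix {A : Herm} {p : HermCoord} (h : A.toMatrix = p.toMatrix) :
    Herm.coord A = p := by
  rw [← Herm.coord.apply_symm_apply p]
  exact congrArg _ (Herm.ext h)

/-- The coordinates on `Herm₀(3, 𝕆)`. -/
noncomputable def Herm0.coord : Herm0 →ₗ[ℂ] HermCoord where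
  toFun A := Herm.coord A.toHerm
  map_add' _ _ := rfl
  map_smul' _ _ := rfl

theorem Herm0.toMatrix_coord (A : Herm0) : A.coord.toMatrix = A.toMatrix :=
  A.toHerm.toMatrix_coord

theorem Herm0.coord_injective : Function.Injective Herm0.coord := fun A B h =>
  Herm0.ext (by rw [← A.toMatrix_coord, ← B.toMatrix_coord, h])

theorem Herm0.trace_coord (A : Herm0) : A.coord.trace = 0 := by
  have h := A.coord.toMatrix_trace
  rw [A.toMatrix_coord, A.trace_eq_zero] at h
  simpa [one_coord] using (congrArg (fun x : Octonion => x 0) h).symm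

/-- The trace-free Hermitian matrix with the given coordinates. -/
noncomputable def Herm0.ofCoord (p : HermCoord) (hp : p.trace = 0) : Herm0 :=
  Herm0.of p.toMatrix p.toMatrix_isHermitian (by rw [p.toMatrix_trace, hp, zero_smul])

theorem Herm0.coord_ofCoord (p : HermCoord) (hp : p.trace = 0) :
    (Herm0.ofCoord p hp).coord = p :=
  Herm.coord_eq_of_toMatrix rfl

theorem coord_sqMap (A : Herm0) : Herm.coord (sqMap A) = A.coord.sq := by
  refine Herm.coord_eq_of_toMatrix ?_
  rw [← HermCoord.toMatrix_mul_self, A.toMatrix_coord]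
  rfl

theorem mem_cone_iff {A : Herm0} : A ∈ cone ↔ A.coord.sq = 0 ∧ A ≠ 0 := by
  rw [← coord_sqMap, LinearEquiv.map_eq_zero_iff]
  rfl

/-- The splitting of `Herm₀(3, 𝕆)` into the coordinates `(y, z)` and `(a, b, x)`. -/
noncomputable def Herm0.splitting : ((Octonion × Octonion) × (ℂ × ℂ × Octonion)) ≃ₗ[ℂ] Herm0 :=
  LinearEquiv.symm
  { toFun A := ((A.coord.2.2.1, A.coord.2.2.2), (A.coord.1.1, A.coord.1.2.1, A.coord.2.1))
    map_add' _ _ := rfl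
    map_smul' _ _ := rfl
    invFun q := Herm0.ofCoord ((q.2.1, q.2.2.1, -q.2.1 - q.2.2.1), (q.2.2.2, q.1.1, q.1.2))
      (by simp [HermCoord.trace])
    left_inv A := by
      refine Herm0.coord_injective ?_
      have h := A.trace_coord
      rw [Herm0.coord_ofCoord]
      have h' : -A.coord.1.1 - A.coord.1.2.1 = A.coord.1.2.2 := by
        rw [HermCoord.trace] at h
        linear_combination -h
      rw [h']
    right_inv q := by simp only [Herm0.coord_ofCoord] }

instance : FiniteDimensional ℂ Herm := Module.Finite.equiv Herm.coord.symm

instance : FiniteDimensional ℂ Herm0 := Module.Finite.equiv Herm0.splitting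

theorem Herm0.finrank_eq : Module.finrank ℂ Herm0 = 26 := by
  rw [← Herm0.splitting.finrank_eq]
  simp [Module.finrank_prod, Octonion.finrank_eq]

/-! ### The Jordan product and the differential of the squaring map. -/

theorem jordanMul_comm (A B : Herm) : jordanMul A B = jordanMul B A :=
  Herm.ext (congrArg ((1 / 2 : ℂ) • ·) (add_comm _ _))

theorem jordanMul_add_left (A A' B : Herm) :
    jordanMul (A + A') B = jordanMul A B + jordanMul A' B := by
  refine Herm.ext ?_
  change (1 / 2 : ℂ) • ((A.toMatrix + A'.toMatrix) * B.toMatrix +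
    B.toMatrix * (A.toMatrix + A'.toMatrix)) = (1 / 2 : ℂ) • (A.toMatrix * B.toMatrix +
    B.toMatrix * A.toMatrix) + (1 / 2 : ℂ) • (A'.toMatrix * B.toMatrix + B.toMatrix * A'.toMatrix)
  rw [← smul_add]
  congr 1
  ext1 i j
  simp only [Matrix.add_apply, Matrix.mul_apply, Fin.sum_univ_three, add_mul', mul_add']
  abel

theorem jordanMul_smul_left (c : ℂ) (A B : Herm) : jordanMul (c • A) B = c • jordanMul A B := by
  refine Herm.ext ?_
  change (1 / 2 : ℂ) • ((c • A.toMatrix) * B.toMatrix + B.toMatrix * (c • A.toMatrix)) =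
    c • (1 / 2 : ℂ) • (A.toMatrix * B.toMatrix + B.toMatrix * A.toMatrix)
  rw [smul_comm c]
  congr 1
  ext1 i j
  simp only [Matrix.add_apply, Matrix.smul_apply, Matrix.mul_apply, Fin.sum_univ_three, smul_mul',
    mul_smul', smul_add]

/-- The Jordan product of trace-free matrices as a continuous bilinear map. -/
noncomputable def jordanBilin : Herm0 →L[ℂ] Herm0 →L[ℂ] Herm :=
  (LinearMap.mk₂ ℂ (fun A B : Herm0 => jordanMul A.toHerm B.toHerm)
    (fun A A' B => jordanMul_add_left A.toHerm A'.toHerm B.toHerm)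
    (fun c A B => jordanMul_smul_left c A.toHerm B.toHerm)
    (fun A B B' => by
      simp only [jordanMul_comm A.toHerm]
      exact jordanMul_add_left B.toHerm B'.toHerm A.toHerm)
    (fun c A B => by
      simp only [jordanMul_comm A.toHerm]
      exact jordanMul_smul_left c B.toHerm A.toHerm)).toContinuousBilinearMap

theorem jordanBilin_apply (A B : Herm0) : jordanBilin A B = jordanMul A.toHerm B.toHerm := rfl

theorem sqMap_eq_jordanBilin (A : Herm0) : sqMap A = jordanBilin A A := by
  refine Herm.ext ?_
  change A.toMatrix * A.toMatrix =
    (1 / 2 : ℂ) • (A.toMatrix * A.toMatrix + A.toMatrix * A.toMatrix)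
  rw [← two_smul ℂ, smul_smul]
  norm_num

theorem contDiff_sqMap {n : ℕ∞ω} : ContDiff ℂ n sqMap := by
  have h : sqMap = (fun q : Herm0 × Herm0 => jordanBilin q.1 q.2) ∘ fun A => (A, A) :=
    funext sqMap_eq_jordanBilin
  rw [h]
  exact jordanBilin.isBoundedBilinearMap.contDiff.comp (contDiff_id.prodMk contDiff_id)

theorem hasFDerivAt_sqMap (A : Herm0) : HasFDerivAt sqMap ((2 : ℂ) • jordanBilin A) A := by
  have h := jordanBilin.hasFDerivAt_of_bilinear (hasFDerivAt_id A) (hasFDerivAt_id A)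
  rw [show sqMap = fun A => jordanBilin A A from funext sqMap_eq_jordanBilin]
  refine h.congr_fderiv (ContinuousLinearMap.ext fun B => ?_)
  simp [two_smul, jordanBilin_apply, jordanMul_comm B.toHerm]

theorem fderiv_sqMap_apply (A B : Herm0) :
    fderiv ℂ sqMap A B = (2 : ℂ) • jordanMul A.toHerm B.toHerm := by
  rw [(hasFDerivAt_sqMap A).fderiv]
  rfl

/-- The map is quadratic, so its expansion to second order is exact. Membership in the kernel of the
differential can therefore be expressed by squares alone, a form on which symmetries act. -/
theorem sqMap_add (A B : Herm0) : sqMap (A + B) = sqMap A + fderiv ℂ sqMap A B + sqMap B := by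
  rw [fderiv_sqMap_apply, ← jordanBilin_apply]
  simp only [sqMap_eq_jordanBilin, map_add, _root_.add_apply, two_smul]
  rw [jordanBilin_apply B A, jordanMul_comm, ← jordanBilin_apply]
  abel

/-- The kernel of the differential of the squaring map, in coordinates. -/
theorem fderiv_sqMap_eq_zero_iff {A B : Herm0} :
    fderiv ℂ sqMap A B = 0 ↔ (A.coord + B.coord).sq = A.coord.sq + B.coord.sq := by
  rw [← map_add, ← coord_sqMap, ← coord_sqMap, ← coord_sqMap, ← map_add,
    Herm.coord.injective.eq_iff, sqMap_add, add_left_inj, add_eq_left]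

/-! ### Symmetries preserving squares and traces. -/

namespace HermCoord

/-- The linear automorphisms of `Herm(3, 𝕆)` which respect squares and traces. -/
structure IsSymmetry (g : HermCoord ≃ₗ[ℂ] HermCoord) : Prop where
  map_sq : ∀ p, (g p).sq = g p.sq
  map_trace : ∀ p, (g p).trace = p.trace

theorem IsSymmetry.trans {g h : HermCoord ≃ₗ[ℂ] HermCoord} (hg : IsSymmetry g)
    (hh : IsSymmetry h) : IsSymmetry (g.trans h) where
  map_sq p := (hh.map_sq (g p)).trans (congrArg h (hg.map_sq p))
  map_trace p := (hh.map_trace (g p)).trans (hg.map_trace p)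

theorem IsSymmetry.refl : IsSymmetry (.refl ℂ HermCoord) := ⟨fun _ => rfl, fun _ => rfl⟩

theorem IsSymmetry.symm {g : HermCoord ≃ₗ[ℂ] HermCoord} (hg : IsSymmetry g) :
    IsSymmetry g.symm where
  map_sq p := g.injective (by rw [← hg.map_sq, g.apply_symm_apply, g.apply_symm_apply])
  map_trace p := by rw [← hg.map_trace, g.apply_symm_apply]

/-- The cyclic permutation of the rows and columns. -/
def rotate : HermCoord ≃ₗ[ℂ] HermCoord where
  toFun p := ((p.1.2.1, p.1.2.2, p.1.1), (p.2.2.1, p.2.2.2, p.2.1))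
  invFun p := ((p.1.2.2, p.1.1, p.1.2.1), (p.2.2.2, p.2.1, p.2.2.1))
  map_add' _ _ := rfl
  map_smul' _ _ := rfl
  left_inv _ := rfl
  right_inv _ := rfl

theorem isSymmetry_rotate : IsSymmetry rotate where
  map_sq p := by
    refine Prod.ext (Prod.ext ?_ (Prod.ext ?_ ?_)) rfl <;> dsimp only [rotate, sq] <;>
      simp only [LinearEquiv.coe_mk, LinearMap.coe_mk, AddHom.coe_mk] <;> ring
  map_trace p := by
    simp only [rotate, trace, LinearEquiv.coe_mk, LinearMap.coe_mk, AddHom.coe_mk]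
    ring

/-- This inverts the third component of a triality map; with `star u` for `u` it serves the opposite
composition too. -/
theorem mul_star_mul_star_mul_self (u z : Octonion) (hu : normSq u = 1) :
    u * (star u * z * star u) * u = z := by
  rw [flexible, mul_star_mul_self, hu, one_smul, mul_star_mul, hu, one_smul]

/-- The triality automorphism given by an octonion of norm one. -/
noncomputable def triality (u : Octonion) (hu : normSq u = 1) : HermCoord ≃ₗ[ℂ] HermCoord where
  toFun p := (p.1, (u * p.2.1, p.2.2.1 * u, star u * p.2.2.2 * star u))
  invFun p := (p.1, (star u * p.2.1, p.2.2.1 * star u, u * p.2.2.2 * u))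
  map_add' p q := by simp only [Prod.fst_add, Prod.snd_add, mul_add', add_mul', Prod.mk_add_mk]
  map_smul' c p := by
    simp only [Prod.smul_fst, Prod.smul_snd, mul_smul', Octonion.smul_mul', Prod.smul_mk, RingHom.id_apply]
  left_inv p := by
    simp only [star_mul_mul, mul_mul_star, hu, one_smul, mul_star_mul_star_mul_self u _ hu]
  right_inv p := by
    have h := mul_star_mul_star_mul_self (star u) p.2.2.2 (by rw [normSq_star, hu])
    rw [star_star'] at h
    simp only [mul_star_mul, mul_star_mul_self, hu, one_smul, h]

theorem triality_apply (u : Octonion) (hu : normSq u = 1) (p : HermCoord) :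
    triality u hu p = (p.1, (u * p.2.1, p.2.2.1 * u, star u * p.2.2.2 * star u)) := rfl

theorem isSymmetry_triality (u : Octonion) (hu : normSq u = 1) : IsSymmetry (triality u hu) where
  map_sq p := by
    -- Each of the three pairwise products transforms like the remaining off-diagonal entry: `hx`
    -- and `hy` come from the right Moufang identity (for `hy` after conjugating), `hz` from the
    -- middle one.
    have hx (y z : Octonion) : star (y * u * (star u * z * star u)) = u * star (y * z) := by
      rw [← right_moufang, mul_mul_star, hu, one_smul, Octonion.star_mul', star_star']
    have hy (z x : Octonion) : star (star u * z * star u * (u * x)) = star (z * x) * u := by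
      rw [Octonion.star_mul', Octonion.star_mul', Octonion.star_mul' _ (star u),
        Octonion.star_mul' (star u), star_star', ← flexible, ← right_moufang, mul_star_mul_self, hu,
        one_smul, ← Octonion.star_mul']
    have hz (x y : Octonion) : star (u * x * (y * u)) = star u * star (x * y) * star u := by
      rw [middle_moufang, Octonion.star_mul', Octonion.star_mul', flexible]
    simp only [triality_apply, sq, normSq_mul, normSq_star, hu, one_mul, mul_one, hx, hy, hz,
      mul_add', add_mul', mul_smul', Octonion.smul_mul']
  map_trace p := rfl

/-- The linear map underlying the orthogonal reflection which mixes the first two rows and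
columns. -/
noncomputable def reflectionMap (s : ℂ) : HermCoord →ₗ[ℂ] HermCoord where
  -- For `s² = 1/2` this is `A ↦ R A Rᵀ`, where `R` has rows `(s, s, 0)`, `(s, -s, 0)`, `(0, 0, 1)`.
  toFun p := (((p.1.1 + p.1.2.1) / 2 + p.2.2.2 0, (p.1.1 + p.1.2.1) / 2 - p.2.2.2 0, p.1.2.2),
    (s • (star p.2.2.1 - p.2.1), s • (p.2.2.1 + star p.2.1),
      ((p.1.1 - p.1.2.1) / 2 + p.2.2.2 0) • (1 : Octonion) - p.2.2.2))
  map_add' p q := by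
    refine Prod.ext (Prod.ext ?_ (Prod.ext ?_ rfl)) (Prod.ext ?_ (Prod.ext ?_ ?_))
    · simp only [Prod.fst_add, Prod.snd_add, Octonion.add_apply]; ring
    · simp only [Prod.fst_add, Prod.snd_add, Octonion.add_apply]; ring
    · simp only [Prod.fst_add, Prod.snd_add, star_add']; module
    · simp only [Prod.fst_add, Prod.snd_add, star_add']; module
    · simp only [Prod.fst_add, Prod.snd_add, Octonion.add_apply]; module
  map_smul' c p := by
    refine Prod.ext (Prod.ext ?_ (Prod.ext ?_ rfl)) (Prod.ext ?_ (Prod.ext ?_ ?_))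
    · simp only [Prod.smul_fst, Prod.smul_snd, Octonion.smul_apply, smul_eq_mul, RingHom.id_apply]; ring
    · simp only [Prod.smul_fst, Prod.smul_snd, Octonion.smul_apply, smul_eq_mul, RingHom.id_apply]; ring
    · simp only [Prod.smul_fst, Prod.smul_snd, star_smul', RingHom.id_apply]; module
    · simp only [Prod.smul_fst, Prod.smul_snd, star_smul', RingHom.id_apply]; module
    · simp only [Prod.smul_fst, Prod.smul_snd, Octonion.smul_apply, smul_eq_mul, RingHom.id_apply]; module

theorem reflectionMap_apply (s : ℂ) (p : HermCoord) : reflectionMap s p =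
    (((p.1.1 + p.1.2.1) / 2 + p.2.2.2 0, (p.1.1 + p.1.2.1) / 2 - p.2.2.2 0, p.1.2.2),
      (s • (star p.2.2.1 - p.2.1), s • (p.2.2.1 + star p.2.1),
        ((p.1.1 - p.1.2.1) / 2 + p.2.2.2 0) • (1 : Octonion) - p.2.2.2)) := rfl

theorem reflectionMap_involutive {s : ℂ} (hs : s * s = 1 / 2) :
    Function.Involutive (reflectionMap s) := by
  intro p
  simp only [reflectionMap_apply]
  refine Prod.ext (Prod.ext ?_ (Prod.ext ?_ rfl)) (Prod.ext ?_ (Prod.ext ?_ ?_))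
  · simp only [Octonion.sub_apply, Octonion.smul_apply, one_coord]; ring
  · simp only [Octonion.sub_apply, Octonion.smul_apply, one_coord]; ring
  · have h : s • (star (s • (p.2.2.1 + star p.2.1)) - s • (star p.2.2.1 - p.2.1)) =
        (2 * (s * s)) • p.2.1 := by
      simp only [star_smul', star_add', star_star']; module
    rw [h, hs]
    norm_num
  · have h : s • (s • (p.2.2.1 + star p.2.1) + star (s • (star p.2.2.1 - p.2.1))) =
        (2 * (s * s)) • p.2.2.1 := by
      apply ext_coord <;> simp only [Octonion.add_apply, Octonion.sub_apply, Octonion.smul_apply, star_coord] <;> ring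
    rw [h, hs]
    norm_num
  · simp only [Octonion.sub_apply, Octonion.smul_apply, one_coord]; module

/-- The orthogonal reflection which mixes the first two rows and columns. -/
noncomputable def reflection {s : ℂ} (hs : s * s = 1 / 2) : HermCoord ≃ₗ[ℂ] HermCoord :=
  .ofInvolutive (reflectionMap s) (reflectionMap_involutive hs)

theorem isSymmetry_reflection {s : ℂ} (hs : s * s = 1 / 2) : IsSymmetry (reflection hs) where
  map_sq := by
    rintro ⟨⟨a, b, c⟩, ⟨x, y, z⟩⟩
    change (reflectionMap s _).sq = reflectionMap s _
    have hn (v : Octonion) : normSq (s • v) = 1 / 2 * normSq v := by rw [normSq_smul, pow_two, hs]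
    have hm (v w : Octonion) : (s • v) * (s • w) = (1 / 2 : ℂ) • (v * w) := by
      rw [Octonion.smul_mul', mul_smul', smul_smul, hs]
    simp only [reflectionMap_apply, HermCoord.sq, hn, hm, Octonion.smul_mul' s, mul_smul' s]
    refine Prod.ext (Prod.ext ?_ (Prod.ext ?_ ?_)) (Prod.ext ?_ (Prod.ext ?_ ?_))
    · simp only [normSq, Octonion.add_apply, Octonion.sub_apply, Octonion.smul_apply, star_coord, one_coord, mul_coord]; ring
    · simp only [normSq, Octonion.add_apply, Octonion.sub_apply, Octonion.smul_apply, star_coord, one_coord, mul_coord]; ring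
    · simp only [normSq, Octonion.add_apply, Octonion.sub_apply, star_coord]; ring
    · apply ext_coord <;>
        simp only [Octonion.add_apply, Octonion.sub_apply, Octonion.smul_apply, star_coord, one_coord, mul_coord] <;> ring
    · apply ext_coord <;>
        simp only [Octonion.add_apply, Octonion.sub_apply, Octonion.smul_apply, star_coord, one_coord, mul_coord] <;> ring
    · apply ext_coord <;>
        simp only [Octonion.add_apply, Octonion.sub_apply, Octonion.smul_apply, star_coord, one_coord, mul_coord, normSq] <;> ring
  map_trace p := by
    change (reflectionMap s p).trace = p.trace
    simp only [reflectionMap_apply, trace]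
    ring

/-- A norm one octonion moving a nonzero octonion to one with nonzero real part. -/
theorem exists_mul_apply_zero_ne {x : Octonion} (hx : x ≠ 0) :
    ∃ u : Octonion, normSq u = 1 ∧ (u * x) 0 ≠ 0 := by
  obtain ⟨i, hi⟩ : ∃ i, x i ≠ 0 := by
    by_contra! h
    exact hx (Octonion.ext h)
  -- For the basis octonion `u` at an index `i` with `x i ≠ 0`, the real part of `u * x` is `± x i`.
  let u : Octonion := fun j => if j = i then 1 else 0
  have hu (j : Fin 8) : u j = if j = i then 1 else 0 := rfl
  refine ⟨u, ?_, ?_⟩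
  · simp only [normSq, hu]
    fin_cases i <;> simp
  · rw [(mul_coord u x).1]
    simp only [hu]
    fin_cases i <;> simpa using hi

/-- The reflection makes the first diagonal entry `(a + b) / 2 + Re z`, which is `Re z` here. -/
theorem exists_isSymmetry_of_re_ne {p : HermCoord} (ha : p.1.1 = 0) (hb : p.1.2.1 = 0)
    (hz : p.2.2.2 0 ≠ 0) : ∃ g, IsSymmetry g ∧ (g p).1.1 ≠ 0 := by
  obtain ⟨s, hs⟩ := IsAlgClosed.exists_eq_mul_self (1 / 2 : ℂ)
  refine ⟨reflection hs.symm, isSymmetry_reflection _, ?_⟩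
  change (p.1.1 + p.1.2.1) / 2 + p.2.2.2 0 ≠ 0
  simpa [ha, hb] using hz

/-- A triality map gives `x` a nonzero real part while keeping the diagonal zero; the rotation then
carries `x` to the place of `z`. -/
theorem exists_isSymmetry_of_off_diag {p : HermCoord} (hd : p.1 = 0) (hx : p.2.1 ≠ 0) :
    ∃ g, IsSymmetry g ∧ (g p).1.1 ≠ 0 := by
  obtain ⟨u, hu, hux⟩ := exists_mul_apply_zero_ne hx
  obtain ⟨g, hg, hgp⟩ := exists_isSymmetry_of_re_ne (p := rotate (triality u hu p))
    (congrArg (fun q : ℂ × ℂ × ℂ => q.2.1) hd) (congrArg (fun q : ℂ × ℂ × ℂ => q.2.2) hd) hux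
  exact ⟨_, ((isSymmetry_triality u hu).trans isSymmetry_rotate).trans hg, hgp⟩

/-- Every nonzero Hermitian matrix can be moved by a symmetry to one whose first diagonal entry
does not vanish. -/
theorem exists_isSymmetry {p : HermCoord} (hp : p ≠ 0) :
    ∃ g, IsSymmetry g ∧ (g p).1.1 ≠ 0 := by
  have h2 := isSymmetry_rotate.trans isSymmetry_rotate
  by_cases ha : p.1.1 = 0; swap
  · exact ⟨_, .refl, ha⟩
  by_cases hb : p.1.2.1 = 0; swap
  · exact ⟨_, isSymmetry_rotate, hb⟩
  by_cases hc : p.1.2.2 = 0; swap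
  · exact ⟨_, h2, hc⟩
  by_cases hx : p.2.1 = 0; swap
  · exact exists_isSymmetry_of_off_diag (Prod.ext ha (Prod.ext hb hc)) hx
  by_cases hy : p.2.2.1 = 0; swap
  · obtain ⟨g, hg, hgp⟩ := exists_isSymmetry_of_off_diag (p := rotate p)
      (Prod.ext hb (Prod.ext hc ha)) hy
    exact ⟨_, isSymmetry_rotate.trans hg, hgp⟩
  by_cases hz : p.2.2.2 = 0; swap
  · obtain ⟨g, hg, hgp⟩ := exists_isSymmetry_of_off_diag (p := rotate (rotate p))
      (Prod.ext hc (Prod.ext ha hb)) hz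
    exact ⟨_, h2.trans hg, hgp⟩
  exact (hp (Prod.ext (Prod.ext ha (Prod.ext hb hc)) (Prod.ext hx (Prod.ext hy hz)))).elim

end HermCoord

open HermCoord

/-- The automorphism of `Herm₀(3, 𝕆)` given by a symmetry. -/
noncomputable def Herm0.congr {g : HermCoord ≃ₗ[ℂ] HermCoord} (hg : IsSymmetry g) :
    Herm0 ≃L[ℂ] Herm0 :=
  LinearEquiv.toContinuousLinearEquiv
  { toFun A := Herm0.ofCoord (g A.coord) (by rw [hg.map_trace, A.trace_coord])
    map_add' A B := Herm0.coord_injective (by simp only [map_add, Herm0.coord_ofCoord])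
    map_smul' c A := Herm0.coord_injective (by
      simp only [map_smul, Herm0.coord_ofCoord, RingHom.id_apply])
    invFun A := Herm0.ofCoord (g.symm A.coord) (by rw [hg.symm.map_trace, A.trace_coord])
    left_inv A := Herm0.coord_injective (by
      simp only [Herm0.coord_ofCoord, LinearEquiv.symm_apply_apply])
    right_inv A := Herm0.coord_injective (by
      simp only [Herm0.coord_ofCoord, LinearEquiv.apply_symm_apply]) }

section

variable {g : HermCoord ≃ₗ[ℂ] HermCoord} (hg : IsSymmetry g)

theorem Herm0.coord_congr (A : Herm0) : (Herm0.congr hg A).coord = g A.coord :=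
  Herm0.coord_ofCoord _ (by rw [hg.map_trace, A.trace_coord])

theorem congr_mem_cone_iff (A : Herm0) : Herm0.congr hg A ∈ cone ↔ A ∈ cone := by
  rw [mem_cone_iff, mem_cone_iff, Herm0.coord_congr, hg.map_sq, LinearEquiv.map_eq_zero_iff, ne_eq,
    ne_eq, ContinuousLinearEquiv.map_eq_zero_iff]

theorem fderiv_sqMap_congr_eq_zero_iff (A B : Herm0) :
    fderiv ℂ sqMap (Herm0.congr hg A) (Herm0.congr hg B) = 0 ↔ fderiv ℂ sqMap A B = 0 := by
  rw [fderiv_sqMap_eq_zero_iff, fderiv_sqMap_eq_zero_iff, Herm0.coord_congr, Herm0.coord_congr,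
    ← map_add g, hg.map_sq, hg.map_sq, hg.map_sq, ← map_add g, g.injective.eq_iff]

end

/-! ### The principal square root on the slit plane. -/

theorem Complex.re_cpow_two_inv_pos {w : ℂ} (hw : w ∈ slitPlane) : 0 < (w ^ (2⁻¹ : ℂ)).re := by
  have h1 := (mem_slitPlane_iff_arg.1 hw)
  rw [cpow_def_of_ne_zero h1.2, exp_re]
  refine mul_pos (Real.exp_pos _) (Real.cos_pos_of_mem_Ioo ?_)
  have h2 : (log w * 2⁻¹).im = arg w / 2 := by
    rw [show (2⁻¹ : ℂ) = ((2⁻¹ : ℝ) : ℂ) by simp, im_mul_ofReal, log_im]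
    ring
  rw [h2]
  have h3 := neg_pi_lt_arg w
  have h4 := lt_of_le_of_ne (arg_le_pi w) h1.1
  constructor <;> linarith

/-- Together with `re_cpow_two_inv_pos`, this matches the right half-plane with the slit plane under
squaring, which pairs the open sets `U` and `V` of the local graph. -/
theorem Complex.sq_mem_slitPlane {u : ℂ} (hu : 0 < u.re) : u ^ 2 ∈ slitPlane := by
  rw [mem_slitPlane_iff, pow_two, mul_re, mul_im]
  by_cases h : u.im = 0
  · left
    rw [h]
    nlinarith
  · right
    intro h'
    have : u.re * u.im = 0 := by linarith
    exact (mul_ne_zero hu.ne' h) this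

/-! ### The equations of the cone where the first entry is nonzero. -/

namespace HermCoord

/-- The relations which hold for trace-free elements of vanishing square. -/
theorem diag_eq_of_sq_eq_zero {p : HermCoord} (hp : p.sq = 0) (ht : p.trace = 0) :
    p.1.1 ^ 2 = -(normSq p.2.2.1 + normSq p.2.2.2) ∧ p.1.1 * p.1.2.1 = normSq p.2.2.2 ∧
      p.1.1 • p.2.1 = star (p.2.2.1 * p.2.2.2) := by
  have h1 : p.1.1 ^ 2 + normSq p.2.2.1 + normSq p.2.2.2 = 0 := congrArg (fun q => q.1.1) hp
  have h2 : p.1.2.1 ^ 2 + normSq p.2.1 + normSq p.2.2.2 = 0 := congrArg (fun q => q.1.2.1) hp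
  have h3 : p.1.2.2 ^ 2 + normSq p.2.1 + normSq p.2.2.1 = 0 := congrArg (fun q => q.1.2.2) hp
  have h4 : (p.1.2.1 + p.1.2.2) • p.2.1 + star (p.2.2.1 * p.2.2.2) = 0 :=
    congrArg (fun q => q.2.1) hp
  have hc : p.1.2.2 = -p.1.1 - p.1.2.1 := by
    rw [trace] at ht
    linear_combination ht
  rw [hc] at h3 h4
  -- After `c = -a - b`, the third diagonal equation minus the other two leaves `2 a b = 2 N(z)`,
  -- and the `x` equation has coefficient `b + c = -a`.
  refine ⟨by linear_combination h1, by linear_combination (h3 - h1 - h2) / 2, ?_⟩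
  rw [eq_comm, ← sub_eq_zero, ← h4]
  module

/-- The trace-free elements of vanishing square with nonzero first entry are determined by their
first entry and the adjacent off-diagonal entries. -/
theorem sq_eq_zero_of_diag_eq {a : ℂ} (ha : a ≠ 0) {y z : Octonion}
    (h : a ^ 2 = -(normSq y + normSq z)) :
    sq ((a, normSq z / a, -a - normSq z / a), (a⁻¹ • star (y * z), y, z)) = 0 := by
  -- The third diagonal entry is `N(y) / a`, which restores the symmetry between `y` and `z`.
  have hc : -a - normSq z / a = normSq y / a := by
    field_simp
    linear_combination -h
  have hn : normSq (a⁻¹ • star (y * z)) = normSq y * normSq z / a ^ 2 := by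
    rw [normSq_smul, normSq_star, normSq_mul, inv_pow, div_eq_inv_mul]
  simp only [sq, hn]
  refine Prod.ext (Prod.ext ?_ (Prod.ext ?_ ?_)) (Prod.ext ?_ (Prod.ext ?_ ?_))
  · change a ^ 2 + normSq y + normSq z = 0
    linear_combination h
  · change (normSq z / a) ^ 2 + normSq y * normSq z / a ^ 2 + normSq z = 0
    field_simp
    linear_combination normSq z * h
  · change (-a - normSq z / a) ^ 2 + normSq y * normSq z / a ^ 2 + normSq y = 0
    rw [hc]
    field_simp
    linear_combination normSq y * h
  · change (normSq z / a + (-a - normSq z / a)) • a⁻¹ • star (y * z) + star (y * z) = 0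
    rw [smul_smul, show (normSq z / a + (-a - normSq z / a)) * a⁻¹ = -1 by field_simp; ring]
    module
  · change (-a - normSq z / a + a) • y + star (z * a⁻¹ • star (y * z)) = 0
    rw [mul_smul', Octonion.star_mul' y, mul_star_mul, star_smul', star_smul', star_star']
    module
  · change (a + normSq z / a) • z + star ((a⁻¹ • star (y * z)) * y) = 0
    rw [Octonion.smul_mul', star_smul', Octonion.star_mul' _ y, star_star', star_mul_mul, smul_smul,
      show a + normSq z / a = -(normSq y / a) by rw [← hc]; ring]
    module

/-- At a trace-free element of vanishing square with nonzero first entry, the kernel of the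
differential of the squaring map is determined by the adjacent off-diagonal entries. -/
theorem eq_zero_of_sq_add {p q : HermCoord} (ha : p.1.1 ≠ 0) (hp : p.trace = 0)
    (hq : q.trace = 0) (h : (p + q).sq = p.sq + q.sq) (hy : q.2.2.1 = 0) (hz : q.2.2.2 = 0) :
    q = 0 := by
  obtain ⟨⟨a, b, c⟩, ⟨x, y, z⟩⟩ := p
  obtain ⟨⟨a', b', c'⟩, ⟨x', y', z'⟩⟩ := q
  obtain rfl : y' = 0 := hy
  obtain rfl : z' = 0 := hz
  have h0 : normSq 0 = 0 := by simp [normSq]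
  have h1 := congrArg (fun q => q.1.1) h
  have h2 := congrArg (fun q => q.1.2.1) h
  have h3 := congrArg (fun q => q.1.2.2) h
  have h4 := congrArg (fun q => q.2.1) h
  simp only [sq, Prod.mk_add_mk, add_zero, h0, mul_zero', star_zero'] at h1 h2 h3 h4
  simp only [trace] at hp hq ha
  -- Only cross terms survive in `h`: the first diagonal entry gives `2 a a' = 0`, then the `x`
  -- entry gives `-a x' = 0`, and half the difference of the last two diagonal entries gives `a b' =
  -- 0`.
  have ha' : a' = 0 := by
    have : a * a' = 0 := by linear_combination h1 / 2
    simpa [ha] using this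
  subst ha'
  obtain rfl : c' = -b' := by linear_combination hq
  obtain rfl : c = -a - b := by linear_combination hp
  have hx : x' = 0 := by
    have h5 : (-a) • x' = 0 := by
      rw [← sub_eq_zero] at h4
      rw [← h4]
      module
    simpa [ha] using h5
  subst hx
  have hb : b' = 0 := by
    rw [add_zero, h0] at h2 h3
    have : a * b' = 0 := by linear_combination (h3 - h2) / 2
    simpa [ha] using this
  subst hb
  simp

end HermCoord

/-! ### Local graphs for the cone. -/

theorem coord_splitting (q : (Octonion × Octonion) × (ℂ × ℂ × Octonion)) :
    (Herm0.splitting q).coord =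
      ((q.2.1, q.2.2.1, -q.2.1 - q.2.2.1), (q.2.2.2, q.1.1, q.1.2)) :=
  Herm0.coord_ofCoord _ (by simp [HermCoord.trace])

/-- The squared quotient of the first entry of an element of the cone by a given one, in terms of
the adjacent off-diagonal entries. -/
noncomputable def coneQuotient (a : ℂ) (v : Octonion × Octonion) : ℂ :=
  -(normSq v.1 + normSq v.2) / a ^ 2

/-- The branch of the first entry of an element of the cone, in terms of the adjacent off-diagonal
entries. -/
noncomputable def coneEntry (a : ℂ) (v : Octonion × Octonion) : ℂ :=
  a * coneQuotient a v ^ (2⁻¹ : ℂ)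

theorem contDiff_coneQuotient (a : ℂ) {n : ℕ∞ω} : ContDiff ℂ n (coneQuotient a) :=
  ((contDiff_normSq.comp contDiff_fst).add (contDiff_normSq.comp contDiff_snd)).neg.div_const _

theorem contDiffOn_coneEntry (a : ℂ) {n : ℕ∞ω} :
    ContDiffOn ℂ n (coneEntry a) (coneQuotient a ⁻¹' Complex.slitPlane) := by
  intro v hv
  refine (contDiffAt_const.mul ?_).contDiffWithinAt
  exact ((analyticAt_id.cpow analyticAt_const hv).contDiffAt (n := n)).comp v
    (contDiff_coneQuotient a).contDiffAt

theorem coneEntry_ne_zero {a : ℂ} (ha : a ≠ 0) {v : Octonion × Octonion}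
    (hv : coneQuotient a v ∈ Complex.slitPlane) : coneEntry a v ≠ 0 := by
  refine mul_ne_zero ha fun h => ?_
  simpa [h] using Complex.re_cpow_two_inv_pos hv

theorem coneEntry_sq {a : ℂ} (ha : a ≠ 0) (v : Octonion × Octonion) :
    coneEntry a v ^ 2 = -(normSq v.1 + normSq v.2) := by
  have h : (coneQuotient a v ^ (2⁻¹ : ℂ)) ^ 2 = coneQuotient a v :=
    Complex.cpow_nat_inv_pow _ two_ne_zero
  rw [coneEntry, mul_pow, h, coneQuotient]
  field_simp

/-- The cone is a graph near a point with nonzero first entry. -/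
noncomputable def coneLocalGraph {p : Herm0} (hp : p ∈ cone) (ha : p.coord.1.1 ≠ 0) {n : ℕ∞ω} :
    LocalGraph n cone p Herm0.splitting.toContinuousLinearEquiv where
  -- The equation for `a²` leaves two opposite roots; positivity of the real part of the ratio to
  -- the entry at `p` selects the one continuing that entry.
  U := {A | 0 < (A.coord.1.1 / p.coord.1.1).re}
  V := coneQuotient p.coord.1.1 ⁻¹' Complex.slitPlane
  ψ v := (coneEntry p.coord.1.1 v, normSq v.2 / coneEntry p.coord.1.1 v,
    (coneEntry p.coord.1.1 v)⁻¹ • star (v.1 * v.2))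
  isOpen_U := by
    have h : Continuous fun A : Herm0 => A.coord := Herm0.coord.toContinuousLinearMap.continuous
    exact isOpen_lt continuous_const
      (Complex.continuous_re.comp ((continuous_fst.comp (continuous_fst.comp h)).div_const _))
  isOpen_V := Complex.isOpen_slitPlane.preimage (contDiff_coneQuotient (n := 0) _).continuous
  mem := ⟨hp, by simp [ha]⟩
  contDiffOn := by
    have h := contDiffOn_coneEntry p.coord.1.1 (n := n)
    refine h.prodMk (ContDiffOn.prodMk ?_ ?_)
    · exact (contDiff_normSq.comp contDiff_snd).contDiffOn.div h fun v hv => coneEntry_ne_zero ha hv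
    · exact (h.inv fun v hv => coneEntry_ne_zero ha hv).smul
        (contDiff_star.comp contDiff_mul).contDiffOn
  apply_mem v hv := by
    have hne := coneEntry_ne_zero ha hv
    have hc := coord_splitting (v, (coneEntry p.coord.1.1 v,
      normSq v.2 / coneEntry p.coord.1.1 v, (coneEntry p.coord.1.1 v)⁻¹ • star (v.1 * v.2)))
    rw [LinearEquiv.coe_toContinuousLinearEquiv']
    refine ⟨mem_cone_iff.2 ⟨?_, fun h => hne ?_⟩, ?_⟩
    · rw [hc]
      exact sq_eq_zero_of_diag_eq hne (coneEntry_sq ha v)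
    · rw [h, map_zero] at hc
      exact (congrArg (fun q : HermCoord => q.1.1) hc).symm
    · rw [Set.mem_ofPred_eq, hc]
      simpa [coneEntry, ha] using Complex.re_cpow_two_inv_pos hv
  fst_mem A hA := by
    have h := (diag_eq_of_sq_eq_zero (mem_cone_iff.1 hA.1).1 A.trace_coord).1
    change -(normSq A.coord.2.2.1 + normSq A.coord.2.2.2) / _ ∈ Complex.slitPlane
    rw [← h, ← div_pow]
    exact Complex.sq_mem_slitPlane hA.2
  snd_eq A hA := by
    obtain ⟨h1, h2, h3⟩ := diag_eq_of_sq_eq_zero (mem_cone_iff.1 hA.1).1 A.trace_coord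
    have h4 : 0 < (A.coord.1.1 / p.coord.1.1).re := hA.2
    have h5 : A.coord.1.1 ≠ 0 := fun h => by simp [h] at h4
    have h6 : coneEntry p.coord.1.1 (A.coord.2.2.1, A.coord.2.2.2) = A.coord.1.1 := by
      rw [coneEntry, coneQuotient, ← h1, ← div_pow, Complex.sq_cpow_two_inv h4]
      field_simp
    change (A.coord.1.1, A.coord.1.2.1, A.coord.2.1) =
      (coneEntry _ (A.coord.2.2.1, A.coord.2.2.2), normSq A.coord.2.2.2 / coneEntry _
        (A.coord.2.2.1, A.coord.2.2.2), (coneEntry _ (A.coord.2.2.1, A.coord.2.2.2))⁻¹ •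
          star (A.coord.2.2.1 * A.coord.2.2.2))
    rw [h6, ← h2, ← h3, mul_div_cancel_left₀ _ h5, smul_smul, inv_mul_cancel₀ h5, one_smul]

/-- The cone is a graph near each of its points, in a splitting whose vertical space meets the
kernel of the differential of the squaring map trivially. -/
theorem exists_coneLocalGraph {p : Herm0} (hp : p ∈ cone) (n : ℕ∞ω) :
    ∃ e : ((Octonion × Octonion) × (ℂ × ℂ × Octonion)) ≃L[ℂ] Herm0,
      Nonempty (LocalGraph n cone p e) ∧
      ∀ B, fderiv ℂ sqMap p B = 0 → (e.symm B).1 = 0 → B = 0 := by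
  obtain ⟨g, hg, ha⟩ := exists_isSymmetry (p := p.coord)
    (fun h => (mem_cone_iff.1 hp).2 (Herm0.coord_injective (h.trans (map_zero _).symm)))
  rw [← Herm0.coord_congr hg] at ha
  refine ⟨_, ⟨(coneLocalGraph ((congr_mem_cone_iff hg p).2 hp) ha).symmetry (Herm0.congr hg)
    (congr_mem_cone_iff hg)⟩, fun B hB h => ?_⟩
  -- After the symmetry, a vertical vector is one with vanishing `y` and `z`, so `eq_zero_of_sq_add`
  -- applies at the moved point.
  rw [← fderiv_sqMap_congr_eq_zero_iff hg, fderiv_sqMap_eq_zero_iff] at hB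
  have h' : ((Herm0.congr hg B).coord.2.2.1, (Herm0.congr hg B).coord.2.2.2) = (0, 0) := h
  have h0 := eq_zero_of_sq_add ha (Herm0.trace_coord _) (Herm0.trace_coord _) hB
    (congrArg Prod.fst h') (congrArg Prod.snd h')
  rw [← map_zero Herm0.coord] at h0
  exact (Herm0.congr hg).map_eq_zero_iff.1 (Herm0.coord_injective h0)

/-! ### The kernel at the canonical point. -/

theorem coord_canonicalPoint :
    canonicalPoint.coord = ((Complex.I, -Complex.I, 0), (0, 0, 1)) := by
  refine Herm.coord_eq_of_toMatrix ?_
  change canonicalMatrix = _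
  rw [canonicalMatrix, HermCoord.toMatrix, neg_smul, zero_smul, star_zero', star_one']

theorem mem_canonicalTangent_iff {B : Herm0} : B ∈ canonicalTangent ↔ ∃ x₁ x₂ : Octonion,
    B.coord = ((Complex.I * x₁ 0, -(Complex.I * x₁ 0), 0), (-(Complex.I • x₂), star x₂, x₁)) := by
  have h (x₁ x₂ : Octonion) : tangentMatrix x₁ x₂ = HermCoord.toMatrix
      ((Complex.I * x₁ 0, -(Complex.I * x₁ 0), 0), (-(Complex.I • x₂), star x₂, x₁)) := by
    have hs : star (-(Complex.I • x₂)) = -(Complex.I • star x₂) := by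
      rw [← neg_smul, star_smul', neg_smul]
    simp only [tangentMatrix, HermCoord.toMatrix, hs, star_star', neg_smul, zero_smul, Octonion.re]
  refine exists₂_congr fun x₁ x₂ => ?_
  rw [h, ← B.toMatrix_coord]
  refine ⟨fun h' => ?_, congrArg _⟩
  rw [B.toMatrix_coord] at h'
  exact Herm.coord_eq_of_toMatrix h'

theorem fderiv_sqMap_canonicalPoint_eq_zero_of_mem {B : Herm0} (hB : B ∈ canonicalTangent) :
    fderiv ℂ sqMap canonicalPoint B = 0 := by
  obtain ⟨x₁, x₂, h⟩ := mem_canonicalTangent_iff.1 hB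
  rw [fderiv_sqMap_eq_zero_iff, h, coord_canonicalPoint]
  have hI : Complex.I * Complex.I = -1 := Complex.I_mul_I
  simp only [HermCoord.sq, Prod.mk_add_mk]
  refine Prod.ext (Prod.ext ?_ (Prod.ext ?_ ?_)) (Prod.ext ?_ (Prod.ext ?_ ?_))
  · simp only [normSq, Octonion.add_apply, zero_apply, one_coord]
    linear_combination (2 * x₁ 0) * hI
  · simp only [normSq, Octonion.add_apply, zero_apply, one_coord]
    linear_combination (2 * x₁ 0) * hI
  · simp only [normSq, Octonion.add_apply, zero_apply]
    ring
  · simp only [zero_add, mul_add', star_add', mul_one', star_zero',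
      star_star', smul_zero, add_zero, smul_neg, smul_smul]
    simp only [add_mul, neg_mul, hI]
    module
  · simp only [zero_add, add_mul', star_add', one_mul', mul_zero', star_zero', add_zero, smul_zero,
      ← neg_smul, star_smul']
    module
  · simp only [zero_add, mul_zero', star_zero', add_zero]
    module

theorem fderiv_sqMap_canonicalPoint_ker :
    {B : Herm0 | fderiv ℂ sqMap canonicalPoint B = 0} = canonicalTangent := by
  refine Set.Subset.antisymm (fun B hB => ?_) fun B => fderiv_sqMap_canonicalPoint_eq_zero_of_mem
  -- `C` is the member of the explicit family with the same `y` and `z` as `B`, namely `x₁ = z` and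
  -- `x₂ = star y`. The difference `B - C` lies in the kernel and has `y = z = 0`, so it vanishes.
  let C : Herm0 := Herm0.ofCoord ((Complex.I * B.coord.2.2.2 0, -(Complex.I * B.coord.2.2.2 0), 0),
    (-(Complex.I • star B.coord.2.2.1), star (star B.coord.2.2.1), B.coord.2.2.2))
    (by simp [HermCoord.trace])
  have hC : C.coord = _ := Herm0.coord_ofCoord _ _
  have hCt : C ∈ canonicalTangent := mem_canonicalTangent_iff.2 ⟨_, _, hC⟩
  have h : fderiv ℂ sqMap canonicalPoint (B - C) = 0 := by
    rw [map_sub, show fderiv ℂ sqMap canonicalPoint B = 0 from hB,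
      fderiv_sqMap_canonicalPoint_eq_zero_of_mem hCt, sub_zero]
  have h0 : (B - C).coord = 0 := by
    refine eq_zero_of_sq_add (p := canonicalPoint.coord) ?_ (Herm0.trace_coord _)
      (Herm0.trace_coord _) (fderiv_sqMap_eq_zero_iff.1 h) ?_ ?_
    · rw [coord_canonicalPoint]
      exact Complex.I_ne_zero
    · rw [map_sub, hC]
      change B.coord.2.2.1 - star (star B.coord.2.2.1) = 0
      rw [star_star', sub_self]
    · rw [map_sub, hC]
      exact sub_self _
  rw [← map_zero Herm0.coord] at h0
  rwa [sub_eq_zero.1 (Herm0.coord_injective h0)]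

/-! ### The rank and the manifold structures. -/

theorem finrank_range_fderiv_sqMap {A : Herm0} (hA : A ∈ cone) :
    Module.finrank ℂ (fderiv ℂ sqMap A).range = 10 := by
  obtain ⟨e, ⟨G⟩, he⟩ := exists_coneLocalGraph hA ω
  obtain ⟨h1, h2⟩ := range_fderiv_param G (by simp)
    (contDiff_sqMap.differentiable (n := 1) (by simp) A).hasFDerivAt (c := 0) (fun B hB => hB.1) he
  set D := fderiv ℂ G.param (e.symm A).1
  have h3 : LinearMap.range (D : (Octonion × Octonion) →ₗ[ℂ] Herm0) =
      LinearMap.ker (fderiv ℂ sqMap A : Herm0 →ₗ[ℂ] Herm) := SetLike.coe_injective h1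
  -- The kernel is the injective image of the pairs of octonions, so rank-nullity reads `rank + 16 =
  -- 26`.
  have h4 := LinearMap.finrank_range_add_finrank_ker (fderiv ℂ sqMap A : Herm0 →ₗ[ℂ] Herm)
  rw [← h3, LinearMap.finrank_range_of_inj h2, Module.finrank_prod, Octonion.finrank_eq,
    Herm0.finrank_eq] at h4
  exact Nat.add_right_cancel h4

/-- The submanifold structure of the cone over a field of scalars for which `f` is a linear
coordinate system on the space of pairs of octonions. -/
theorem exists_cone_manifold {𝕜 H : Type*} [NontriviallyNormedField 𝕜] [NormedAlgebra 𝕜 ℂ]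
    [NormedSpace 𝕜 Octonion] [NormedSpace 𝕜 Herm0] [NormedSpace 𝕜 Herm]
    [IsScalarTower 𝕜 ℂ Octonion] [IsScalarTower 𝕜 ℂ Herm0] [IsScalarTower 𝕜 ℂ Herm]
    [NormedAddCommGroup H] [NormedSpace 𝕜 H] (f : H ≃L[𝕜] Octonion × Octonion) {n : ℕ∞ω}
    (hn : n ≠ 0) :
    ∃ _ : ChartedSpace H cone,
      IsManifold 𝓘(𝕜, H) n cone ∧
      Manifold.IsSmoothEmbedding 𝓘(𝕜, H) 𝓘(𝕜, Herm0) n (Subtype.val : cone → Herm0) ∧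
      Set.range (mfderiv 𝓘(𝕜, H) 𝓘(𝕜, Herm0)
        (Subtype.val : cone → Herm0) ⟨canonicalPoint, canonicalPoint_mem_cone⟩) =
          canonicalTangent := by
  choose e G he using fun q : cone => exists_coneLocalGraph q.2 ω
  -- The analytic complex graphs are reread over `𝕜`, so one construction serves both the complex
  -- and the real structure.
  let G' (q : cone) := (G q).some.restrictScalars (𝕜' := 𝕜) (m := n) le_top f
  refine ⟨chartedSpaceOfLocalGraph G', isManifold_of_localGraph G',
    isSmoothEmbedding_of_localGraph G', ?_⟩
  let q : cone := ⟨canonicalPoint, canonicalPoint_mem_cone⟩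
  have h1 := mfderiv_val_of_localGraph G' hn q
  -- The differential over `𝕜` is the complex one with scalars restricted, so its kernel is the same
  -- set.
  have hd : HasFDerivAt sqMap ((fderiv ℂ sqMap canonicalPoint).restrictScalars 𝕜)
    canonicalPoint := (contDiff_sqMap.differentiable (n := 1) (by simp) canonicalPoint
      ).hasFDerivAt.restrictScalars 𝕜
  have h2 := (range_fderiv_param (G' q) hn hd (c := 0) (fun B hB => hB.1) fun B hB hB' =>
    he q B hB (f.symm.map_eq_zero_iff.1 hB')).1
  rw [← fderiv_sqMap_canonicalPoint_ker]
  refine Eq.trans ?_ h2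
  exact congrArg (fun D : H →L[𝕜] Herm0 => Set.range D) h1

theorem mainTheorem3 :
    -- `f` is smooth, and its differential at `A` is `B ↦ 2 A ∘ B`
    (ContDiff ℂ ω sqMap ∧
      ∀ A B : Herm0, fderiv ℂ sqMap A B = (2 : ℂ) • jordanMul A.toHerm B.toHerm) ∧
    -- the differential of `f` has constant rank on the cone
    (∀ A ∈ cone, Module.finrank ℂ (fderiv ℂ sqMap A).range = 10) ∧
    -- its kernel at the canonical point
    {B : Herm0 | fderiv ℂ sqMap canonicalPoint B = 0} = canonicalTangent ∧
    -- the cone is an embedded complex submanifold of complex dimension 16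
    (∃ _ : ChartedSpace (EuclideanSpace ℂ (Fin 16)) cone,
      IsManifold 𝓘(ℂ, EuclideanSpace ℂ (Fin 16)) ω cone ∧
      Manifold.IsSmoothEmbedding 𝓘(ℂ, EuclideanSpace ℂ (Fin 16)) 𝓘(ℂ, Herm0) ω
        (Subtype.val : cone → Herm0) ∧
      Set.range (mfderiv 𝓘(ℂ, EuclideanSpace ℂ (Fin 16)) 𝓘(ℂ, Herm0)
        (Subtype.val : cone → Herm0) ⟨canonicalPoint, canonicalPoint_mem_cone⟩) =
          canonicalTangent) ∧
    -- the cone is an embedded smooth real submanifold of real dimension 32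
    (∃ _ : ChartedSpace (EuclideanSpace ℝ (Fin 32)) cone,
      IsManifold 𝓘(ℝ, EuclideanSpace ℝ (Fin 32)) ∞ cone ∧
      Manifold.IsSmoothEmbedding 𝓘(ℝ, EuclideanSpace ℝ (Fin 32)) 𝓘(ℝ, Herm0) ∞
        (Subtype.val : cone → Herm0) ∧
      Set.range (mfderiv 𝓘(ℝ, EuclideanSpace ℝ (Fin 32)) 𝓘(ℝ, Herm0)
        (Subtype.val : cone → Herm0) ⟨canonicalPoint, canonicalPoint_mem_cone⟩) =
          canonicalTangent) := by
  refine ⟨⟨contDiff_sqMap, fderiv_sqMap_apply⟩, fun A => finrank_range_fderiv_sqMap,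
    fderiv_sqMap_canonicalPoint_ker, ?_, ?_⟩
  · refine exists_cone_manifold (ContinuousLinearEquiv.ofFinrankEq ?_) (by simp)
    rw [Module.finrank_prod, Octonion.finrank_eq, finrank_euclideanSpace_fin]
  · have : Module.finrank ℝ (EuclideanSpace ℝ (Fin 32)) =
        Module.finrank ℝ (Octonion × Octonion) := by
      rw [Module.finrank_prod, finrank_real_of_complex, Octonion.finrank_eq,
        finrank_euclideanSpace_fin]
    have : FiniteDimensional ℝ Octonion := FiniteDimensional.complexToReal Octonion
    exact exists_cone_manifold (ContinuousLinearEquiv.ofFinrankEq ‹_›) (by simp)
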